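/- Let $F$ be a computable field, finite or countably infinite: there is a surjection $\mathbb{N}\to F$ for which equality, addition and multiplication are computable on numbers. (Equivalently, up to computable isomorphism, the domain of $F$ is a computable set of natural numbers and its operations are computable.) Let $V_\infty$ be the $\aleph_0$-dimensional vector space of finitely nonzero sequences $(x_0,x_1,\dots)$ of elements of $F$, with the induced computable presentation, in which a vector is coded by a finite list of codes of its coordinates. For a Turing degree $\mathbf d$ (the degree of a set of natural numbers), let $\mathcal L_{\mathbf d}(V_\infty)$ be the lattice, under sum and intersection, of all $\mathbf d$-computably enumerable subspaces of $V_\infty$, and let $\mathrm{Aut}(\mathcal L_{\mathbf d}(V_\infty))$ be the group of all its lattice automorphisms. Let $\mathcal B_\eta$ be the interval Boolean algebra of the ordered set $\mathbb Q$ of rationals, that is, the Boolean algebra of subsets of $\mathbb Q$ generated by the left-closed right-open intervals $[a,b)$, $[a,\infty)$, $(-\infty,b)$, with its standard computable presentation, in which an element is coded through the finitely many rational endpoints of its intervals. Let $\mathrm{Aut}_{\mathbf d}(\mathcal B_\eta)$ be the group of all automorphisms of $\mathcal B_\eta$ that are computable in $\mathbf d$. For groups write $G\hookrightarrow H$ if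 there is an injective group homomorphism $G\to H$. Then for all Turing degrees $\mathbf a,\mathbf b$: $$\mathrm{Aut}(\mathcal L_{\mathbf a}(V_\infty))\hookrightarrow \mathrm{Aut}(\mathcal L_{\mathbf b}(V_\infty))\iff \mathbf a\le\mathbf b,$$ $$\mathrm{Aut}_{\mathbf a}(\mathcal B_\eta)\hookrightarrow \mathrm{Aut}_{\mathbf b}(\mathcal B_\eta)\iff \mathbf a\le\mathbf b.$$ -/

import Mathlib

/-! ### Turing degrees and computability relative to a degree -/

/-- The Turing degree of a (partial) function on the natural numbers. -/
def degOf (f : ℕ →. ℕ) : TuringDegree := toAntisymmetrization TuringReducible f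

open Classical in
/-- The characteristic function of a set of natural numbers. -/
noncomputable def charFun (A : Set ℕ) : ℕ → ℕ := fun n => if n ∈ A then 1 else 0

/-- The Turing degrees in the usual sense: degrees of sets of natural numbers. (Mathlib's
`TuringDegree` also contains degrees of partial functions that are not degrees of sets.)
The order is the one induced by Turing reducibility. -/
abbrev SetDegree : Type :=
  {d : TuringDegree // ∃ A : Set ℕ, d = degOf (charFun A : ℕ →. ℕ)}

/-- A total function `g : ℕ → ℕ` is `d`-computable if `deg g ≤ d`. -/
def ComputableInDeg (d : SetDegree) (g : ℕ → ℕ) : Prop :=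
  degOf (g : ℕ →. ℕ) ≤ d.1

theorem degOf_le_iff {f g : ℕ →. ℕ} : degOf f ≤ degOf g ↔ TuringReducible f g := Iff.rfl

theorem computableInDeg_mk {A : Set ℕ} {g : ℕ → ℕ} (h) :
    ComputableInDeg ⟨degOf (charFun A : ℕ →. ℕ), h⟩ g ↔
      Nat.RecursiveIn {(charFun A : ℕ →. ℕ)} (g : ℕ →. ℕ) :=
  RecursiveIn.iff_nat

theorem ComputableInDeg.of_computable {d : SetDegree} {g : ℕ → ℕ} (hg : Computable g) :
    ComputableInDeg d g := by
  obtain ⟨_, A, rfl⟩ := d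
  exact hg.partrec.recursiveIn

theorem ComputableInDeg.comp {d : SetDegree} {f g : ℕ → ℕ}
    (hf : ComputableInDeg d f) (hg : ComputableInDeg d g) :
    ComputableInDeg d (fun n => f (g n)) := by
  obtain ⟨_, A, rfl⟩ := d
  rw [computableInDeg_mk] at *
  exact (hf.comp hg).of_eq fun n => Part.bind_some _ _

theorem ComputableInDeg.pair {d : SetDegree} {f g : ℕ → ℕ}
    (hf : ComputableInDeg d f) (hg : ComputableInDeg d g) :
    ComputableInDeg d (fun n => Nat.pair (f n) (g n)) := by
  obtain ⟨_, A, rfl⟩ := d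
  rw [computableInDeg_mk] at *
  exact (hf.pair hg).of_eq fun n => by simp [Seq.seq]

theorem ComputableInDeg.comp₂ {d : SetDegree} {h : ℕ → ℕ → ℕ} {f g : ℕ → ℕ}
    (hh : Computable₂ h) (hf : ComputableInDeg d f) (hg : ComputableInDeg d g) :
    ComputableInDeg d (fun n => h (f n) (g n)) := by
  have h1 : Computable fun n : ℕ => h n.unpair.1 n.unpair.2 :=
    hh.comp (Computable.fst.comp Computable.unpair) (Computable.snd.comp Computable.unpair)
  simpa using (ComputableInDeg.of_computable h1).comp (hf.pair hg)

theorem ComputableInDeg.rfind {d : SetDegree} {f g : ℕ → ℕ} (hf : ComputableInDeg d f)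
    (hg : ∀ n, f (Nat.pair n (g n)) = 0 ∧ ∀ m < g n, f (Nat.pair n m) ≠ 0) :
    ComputableInDeg d g := by
  obtain ⟨_, A, rfl⟩ := d
  rw [computableInDeg_mk] at *
  refine (Nat.RecursiveIn.rfind hf).of_eq_tot fun n => ?_
  refine Nat.mem_rfind.2 ⟨?_, fun {m} hm => ?_⟩
  · simp [(hg n).1]
  · simp [(hg n).2 m hm]

/-! ### Numberings

A computable structure is given by a numbering `ν` of its domain by natural numbers
(every element has at least one number) such that equality and the operations are computable on
numbers. Choosing the least number of each element gives an isomorphic copy whose domain is a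
computable set of natural numbers, and the notions below do not change. -/

/-- The map `f` is `d`-computable with respect to the numbering `ν`. -/
def MapComputableIn {α : Type*} (ν : ℕ → α) (d : SetDegree) (f : α → α) : Prop :=
  ∃ g : ℕ → ℕ, ComputableInDeg d g ∧ ∀ n, ν (g n) = f (ν n)

/-- A nonempty subset `W` is `d`-computably enumerable with respect to the numbering `ν`:
its elements are listed by a `d`-computable sequence of numbers. -/
def EnumerableIn {α : Type*} (ν : ℕ → α) (d : SetDegree) (W : Set α) : Prop :=
  ∃ g : ℕ → ℕ, ComputableInDeg d g ∧ Set.range (fun n => ν (g n)) = W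

theorem MapComputableIn.id {α : Type*} (ν : ℕ → α) (d : SetDegree) :
    MapComputableIn ν d (fun x => x) :=
  ⟨fun n => n, .of_computable Computable.id, fun _ => rfl⟩

theorem MapComputableIn.comp {α : Type*} {ν : ℕ → α} {d : SetDegree} {f f' : α → α}
    (hf : MapComputableIn ν d f) (hf' : MapComputableIn ν d f') :
    MapComputableIn ν d (fun x => f (f' x)) := by
  obtain ⟨g, hg, h⟩ := hf
  obtain ⟨g', hg', h'⟩ := hf'
  exact ⟨_, hg.comp hg', fun n => by rw [h, h']⟩

theorem MapComputableIn.symm {α : Type*} {ν : ℕ → α} (hν : Function.Surjective ν)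
    {e : ℕ → ℕ → Bool} (he : Computable₂ e) (hνe : ∀ m n, e m n = true ↔ ν m = ν n)
    {d : SetDegree} (f : α ≃ α) (hf : MapComputableIn ν d f) :
    MapComputableIn ν d f.symm := by
  classical
  obtain ⟨g, hg, h⟩ := hf
  have hex : ∀ n, ∃ m, e (g m) n = true := fun n => by
    obtain ⟨m, hm⟩ := hν (f.symm (ν n))
    exact ⟨m, by rw [hνe, h, hm, f.apply_symm_apply]⟩
  refine ⟨fun n => Nat.find (hex n), ?_, fun n => ?_⟩
  · have hc : Computable₂ fun m n : ℕ => bif e m n then 0 else 1 :=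
      Computable.cond he (Computable.const 0) (Computable.const 1)
    have h1 : Computable fun n : ℕ => n.unpair.1 := Computable.fst.comp Computable.unpair
    have h2 : Computable fun n : ℕ => n.unpair.2 := Computable.snd.comp Computable.unpair
    refine ComputableInDeg.rfind
      (ComputableInDeg.comp₂ hc (hg.comp (.of_computable h2)) (.of_computable h1)) fun n => ?_
    refine ⟨?_, fun m hm => ?_⟩
    · simp [Nat.find_spec (hex n)]
    · simp [Nat.find_min (hex n) hm]
  · have := Nat.find_spec (hex n)
    rw [hνe, h] at this
    rw [← this, f.symm_apply_apply]

/-! ### Computable fields, the space `V_∞` and the lattices `L_d(V_∞)` -/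

/-- A computable presentation of a (finite or countably infinite) field. -/
structure ComputableField (F : Type*) [Field F] where
  /-- the element with a given number -/
  elt : ℕ → F
  surjective : Function.Surjective elt
  eq_computable : ComputablePred fun p : ℕ × ℕ => elt p.1 = elt p.2
  add_computable : ∃ g : ℕ → ℕ → ℕ, Computable₂ g ∧ ∀ m n, elt (g m n) = elt m + elt n
  mul_computable : ∃ g : ℕ → ℕ → ℕ, Computable₂ g ∧ ∀ m n, elt (g m n) = elt m * elt n

/-- The vector space `V_∞` of finitely nonzero sequences of elements of `F`. -/
abbrev VInf (F : Type*) [Field F] : Type _ := ℕ →₀ F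

/-- The vector `(ν l₀, …, ν lₖ, 0, 0, …)` given by the list of numbers `l₀, …, lₖ`. -/
noncomputable def listVec {F : Type*} [Field F] (ν : ComputableField F) (l : List ℕ) : VInf F :=
  Finsupp.onFinset (Finset.range l.length) (fun i => (l[i]?).elim 0 ν.elt) fun i hi => by
    by_contra h
    rw [Finset.mem_range, not_lt] at h
    exact hi (by rw [List.getElem?_eq_none h]; rfl)

/-- The numbering of `V_∞`: numbers code finite lists of numbers of field elements. -/
noncomputable def vecNum {F : Type*} [Field F] (ν : ComputableField F) (n : ℕ) : VInf F :=
  listVec ν (Denumerable.ofNat (List ℕ) n)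

theorem vecNum_encode {F : Type*} [Field F] (ν : ComputableField F) (l : List ℕ) :
    vecNum ν (Encodable.encode l) = listVec ν l := by
  simp [vecNum]

theorem exists_add_vecNum {F : Type*} [Field F] (ν : ComputableField F) :
    ∃ g : ℕ → ℕ → ℕ, Computable₂ g ∧ ∀ m n, vecNum ν (g m n) = vecNum ν m + vecNum ν n := by
  obtain ⟨z, hz⟩ := ν.surjective 0
  obtain ⟨a, ha, hadd⟩ := ν.add_computable
  let s : List ℕ → List ℕ → ℕ → List ℕ := fun l l' n =>
    Nat.rec (motive := fun _ => List ℕ) []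
      (fun k acc => acc ++ [a ((l[k]?).getD z) ((l'[k]?).getD z)]) n
  have hlen : ∀ l l' n, (s l l' n).length = n := fun l l' n => by
    induction n with
    | zero => rfl
    | succ n ih => simp only [s, List.length_append, List.length_singleton] at ih ⊢; rw [ih]
  have hget : ∀ l l' n i, i < n →
      (s l l' n)[i]? = some (a ((l[i]?).getD z) ((l'[i]?).getD z)) := fun l l' n => by
    induction n with
    | zero => intro i hi; omega
    | succ n ih =>
      intro i hi
      have hs : s l l' (n + 1) = s l l' n ++ [a ((l[n]?).getD z) ((l'[n]?).getD z)] := rfl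
      rw [hs, List.getElem?_append, hlen]
      split_ifs with h
      · exact ih i h
      · obtain rfl : i = n := by omega
        simp
  have hz' : ∀ o : Option ℕ, ν.elt (o.getD z) = o.elim 0 ν.elt := fun o => by cases o <;> simp [hz]
  have hs : ∀ l l', listVec ν (s l l' (l.length + l'.length)) = listVec ν l + listVec ν l' := by
    intro l l'
    ext i
    simp only [listVec, Finsupp.add_apply, Finsupp.onFinset_apply]
    by_cases hi : i < l.length + l'.length
    · rw [hget _ _ _ _ hi]
      simp only [Option.elim_some, hadd, hz']
    · rw [List.getElem?_eq_none (by rw [hlen]; omega), List.getElem?_eq_none (by omega),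
        List.getElem?_eq_none (by omega)]
      simp
  refine ⟨fun m n => Encodable.encode (s (Denumerable.ofNat (List ℕ) m)
    (Denumerable.ofNat (List ℕ) n) ((Denumerable.ofNat (List ℕ) m).length +
      (Denumerable.ofNat (List ℕ) n).length)), ?_, fun m n => ?_⟩
  · have h1 : Computable fun p : ℕ × ℕ => Denumerable.ofNat (List ℕ) p.1 :=
      (Computable.ofNat _).comp Computable.fst
    have h2 : Computable fun p : ℕ × ℕ => Denumerable.ofNat (List ℕ) p.2 :=
      (Computable.ofNat _).comp Computable.snd
    have hadd2 : Computable₂ fun m n : ℕ => m + n := Primrec.nat_add.to_comp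
    have hk : Computable fun q : (ℕ × ℕ) × ℕ × List ℕ => q.2.1 :=
      Computable.fst.comp Computable.snd
    have g1 : Computable fun q : (ℕ × ℕ) × ℕ × List ℕ =>
        ((Denumerable.ofNat (List ℕ) q.1.1)[q.2.1]?).getD z :=
      Computable.option_getD (Computable.list_getElem?.comp (h1.comp Computable.fst) hk)
        (Computable.const z)
    have g2 : Computable fun q : (ℕ × ℕ) × ℕ × List ℕ =>
        ((Denumerable.ofNat (List ℕ) q.1.2)[q.2.1]?).getD z :=
      Computable.option_getD (Computable.list_getElem?.comp (h2.comp Computable.fst) hk)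
        (Computable.const z)
    have hstep : Computable₂ fun (p : ℕ × ℕ) (q : ℕ × List ℕ) =>
        q.2 ++ [a (((Denumerable.ofNat (List ℕ) p.1)[q.1]?).getD z)
          (((Denumerable.ofNat (List ℕ) p.2)[q.1]?).getD z)] :=
      Computable.list_concat.comp (Computable.snd.comp Computable.snd) (ha.comp g1 g2)
    exact Computable.encode.comp (Computable.nat_rec
      (hadd2.comp (Computable.list_length.comp h1) (Computable.list_length.comp h2))
      (Computable.const []) hstep)
  · rw [vecNum_encode, hs]
    rfl

theorem exists_eq_vecNum {F : Type*} [Field F] (ν : ComputableField F) :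
    ∃ e : ℕ → ℕ → Bool, Computable₂ e ∧ ∀ m n, e m n = true ↔ vecNum ν m = vecNum ν n := by
  classical
  obtain ⟨z, hz⟩ := ν.surjective 0
  have hq : Computable fun p : ℕ × ℕ => decide (ν.elt p.1 = ν.elt p.2) := ν.eq_computable.decide
  let s : List ℕ → List ℕ → ℕ → Bool := fun l l' n =>
    Nat.rec (motive := fun _ => Bool) true
      (fun k acc => bif acc then decide (ν.elt ((l[k]?).getD z) = ν.elt ((l'[k]?).getD z))
        else false) n
  have hz' : ∀ o : Option ℕ, ν.elt (o.getD z) = o.elim 0 ν.elt := fun o => by cases o <;> simp [hz]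
  have hs : ∀ l l' n, s l l' n = true ↔ ∀ i < n, listVec ν l i = listVec ν l' i := by
    intro l l' n
    induction n with
    | zero => simp [s]
    | succ n ih =>
      have : s l l' (n + 1) = bif s l l' n then
        decide (ν.elt ((l[n]?).getD z) = ν.elt ((l'[n]?).getD z)) else false := rfl
      rw [this, Nat.forall_lt_succ_right, ← ih]
      simp only [listVec, Finsupp.onFinset_apply, ← hz']
      cases s l l' n <;> simp
  have hs' : ∀ l l', s l l' (l.length + l'.length) = true ↔ listVec ν l = listVec ν l' := by
    intro l l'
    rw [hs]
    refine ⟨fun h => Finsupp.ext fun i => ?_, fun h i _ => by rw [h]⟩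
    by_cases hi : i < l.length + l'.length
    · exact h i hi
    · simp only [listVec, Finsupp.onFinset_apply]
      rw [List.getElem?_eq_none (by omega), List.getElem?_eq_none (by omega)]
  refine ⟨fun m n => s (Denumerable.ofNat (List ℕ) m)
    (Denumerable.ofNat (List ℕ) n) ((Denumerable.ofNat (List ℕ) m).length +
      (Denumerable.ofNat (List ℕ) n).length), ?_, fun m n => hs' _ _⟩
  have h1 : Computable fun p : ℕ × ℕ => Denumerable.ofNat (List ℕ) p.1 :=
    (Computable.ofNat _).comp Computable.fst
  have h2 : Computable fun p : ℕ × ℕ => Denumerable.ofNat (List ℕ) p.2 :=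
    (Computable.ofNat _).comp Computable.snd
  have hadd2 : Computable₂ fun m n : ℕ => m + n := Primrec.nat_add.to_comp
  have hk : Computable fun q : (ℕ × ℕ) × ℕ × Bool => q.2.1 :=
    Computable.fst.comp Computable.snd
  have g1 : Computable fun q : (ℕ × ℕ) × ℕ × Bool =>
      ((Denumerable.ofNat (List ℕ) q.1.1)[q.2.1]?).getD z :=
    Computable.option_getD (Computable.list_getElem?.comp (h1.comp Computable.fst) hk)
      (Computable.const z)
  have g2 : Computable fun q : (ℕ × ℕ) × ℕ × Bool =>
      ((Denumerable.ofNat (List ℕ) q.1.2)[q.2.1]?).getD z :=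
    Computable.option_getD (Computable.list_getElem?.comp (h2.comp Computable.fst) hk)
      (Computable.const z)
  have hstep : Computable₂ fun (p : ℕ × ℕ) (q : ℕ × Bool) =>
      bif q.2 then decide (ν.elt (((Denumerable.ofNat (List ℕ) p.1)[q.1]?).getD z) =
        ν.elt (((Denumerable.ofNat (List ℕ) p.2)[q.1]?).getD z)) else false :=
    Computable.cond (Computable.snd.comp Computable.snd) (hq.comp (g1.pair g2))
      (Computable.const false)
  exact Computable.nat_rec
    (hadd2.comp (Computable.list_length.comp h1) (Computable.list_length.comp h2))
    (Computable.const true) hstep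

/-- `L_d(V_∞)`: the lattice of `d`-computably enumerable subspaces of `V_∞`, a sublattice of the
lattice of all subspaces. -/
noncomputable def LatticeOfCESubspaces {F : Type*} [Field F] (ν : ComputableField F)
    (d : SetDegree) : Sublattice (Submodule F (VInf F)) where
  carrier := {W | EnumerableIn (vecNum ν) d (W : Set (VInf F))}
  supClosed' := by
    rintro U ⟨f, hf, hU⟩ W ⟨g, hg, hW⟩
    obtain ⟨a, ha, hadd⟩ := exists_add_vecNum ν
    have h1 : Computable fun n : ℕ => n.unpair.1 := Computable.fst.comp Computable.unpair
    have h2 : Computable fun n : ℕ => n.unpair.2 := Computable.snd.comp Computable.unpair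
    refine ⟨_, ComputableInDeg.comp₂ ha (hf.comp (.of_computable h1))
      (hg.comp (.of_computable h2)), ?_⟩
    ext v
    rw [SetLike.mem_coe, Submodule.mem_sup]
    constructor
    · rintro ⟨n, rfl⟩
      refine ⟨_, ?_, _, ?_, (hadd _ _).symm⟩
      · rw [← SetLike.mem_coe, ← hU]; exact ⟨_, rfl⟩
      · rw [← SetLike.mem_coe, ← hW]; exact ⟨_, rfl⟩
    · rintro ⟨x, hx, y, hy, rfl⟩
      rw [← SetLike.mem_coe, ← hU] at hx
      rw [← SetLike.mem_coe, ← hW] at hy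
      obtain ⟨i, rfl⟩ := hx
      obtain ⟨j, rfl⟩ := hy
      exact ⟨Nat.pair i j, by simp [hadd]⟩
  infClosed' := by
    rintro U ⟨f, hf, hU⟩ W ⟨g, hg, hW⟩
    obtain ⟨e, he, heq⟩ := exists_eq_vecNum ν
    have h1 : Computable fun n : ℕ => n.unpair.1 := Computable.fst.comp Computable.unpair
    have h2 : Computable fun n : ℕ => n.unpair.2 := Computable.snd.comp Computable.unpair
    have hc : Computable₂ fun m n : ℕ => bif e m n then m else Encodable.encode ([] : List ℕ) :=
      Computable.cond he Computable.fst (Computable.const _)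
    have h0 : vecNum ν (Encodable.encode ([] : List ℕ)) = 0 := by
      rw [vecNum_encode]; ext i; simp [listVec]
    refine ⟨_, ComputableInDeg.comp₂ hc (hf.comp (.of_computable h1))
      (hg.comp (.of_computable h2)), ?_⟩
    ext v
    rw [SetLike.mem_coe, Submodule.mem_inf]
    constructor
    · rintro ⟨n, rfl⟩
      cases h : e (f n.unpair.1) (g n.unpair.2)
      · simp only [h, cond_false, h0]
        exact ⟨U.zero_mem, W.zero_mem⟩
      · simp only [h, cond_true]
        rw [← SetLike.mem_coe, ← SetLike.mem_coe, ← hU, ← hW]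
        exact ⟨⟨_, rfl⟩, ⟨_, ((heq _ _).1 h).symm⟩⟩
    · rintro ⟨hx, hy⟩
      rw [← SetLike.mem_coe, ← hU] at hx
      rw [← SetLike.mem_coe, ← hW] at hy
      obtain ⟨i, rfl⟩ := hx
      obtain ⟨j, hj⟩ := hy
      refine ⟨Nat.pair i j, ?_⟩
      have := (heq (f i) (g j)).2 hj.symm
      simp [this]

/-! ### The interval Boolean algebra `B_η` and its `d`-computable automorphisms -/

/-- The interval algebra of the rationals: the Boolean algebra of sets of rationals generated by
the left-closed right-open intervals `[a, b)`, `[a, ∞)`, `(-∞, b)`. -/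
def BEta : BooleanSubalgebra (Set ℚ) :=
  BooleanSubalgebra.closure
    ({S | ∃ a b : ℚ, S = Set.Ico a b} ∪ {S | ∃ a : ℚ, S = Set.Ici a} ∪ {S | ∃ b : ℚ, S = Set.Iio b})

/-- The rational number `(i - j) / (k + 1)` with number `⟨⟨i, j⟩, k⟩`. -/
def ratNum (n : ℕ) : ℚ :=
  ((n.unpair.1.unpair.1 : ℚ) - (n.unpair.1.unpair.2 : ℚ)) / ((n.unpair.2 : ℚ) + 1)

/-- The rays: number `0` is `(-∞, ∞)`, number `n + 1` is `[q, ∞)` where `q` has number `n`. -/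
def rayNum : ℕ → Set ℚ
  | 0 => Set.univ
  | n + 1 => Set.Ici (ratNum n)

/-- The symmetric difference of a finite list of rays. -/
def raySum (l : List ℕ) : Set ℚ := l.foldr (fun k S => symmDiff (rayNum k) S) ∅

theorem rayNum_mem (k : ℕ) : rayNum k ∈ BEta := by
  cases k with
  | zero => exact BooleanSubalgebra.top_mem
  | succ n => exact BooleanSubalgebra.mem_closure_of_mem (Or.inl (Or.inr ⟨_, rfl⟩))

theorem raySum_mem (l : List ℕ) : raySum l ∈ BEta := by
  induction l with
  | nil => exact BooleanSubalgebra.bot_mem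
  | cons k l ih =>
    exact BooleanSubalgebra.sup_mem (BooleanSubalgebra.sdiff_mem (rayNum_mem k) ih)
      (BooleanSubalgebra.sdiff_mem ih (rayNum_mem k))

/-- The numbering of `B_η`: numbers code finite lists of rays, of which the symmetric difference is
taken. (For `a < b`, the interval `[a, b)` is the symmetric difference of two rays, and every
element of `B_η` arises in this way.) -/
def bEtaNum (n : ℕ) : BEta := ⟨raySum (Denumerable.ofNat (List ℕ) n), raySum_mem _⟩

theorem raySum_append (l l' : List ℕ) : raySum (l ++ l') = symmDiff (raySum l) (raySum l') := by
  induction l with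
  | nil => exact (bot_symmDiff _).symm
  | cons k l ih =>
    simp only [raySum, List.cons_append, List.foldr_cons] at ih ⊢
    rw [ih, symmDiff_assoc]

theorem ratNum_surjective : Function.Surjective ratNum := fun q => by
  refine ⟨Nat.pair (Nat.pair q.num.toNat (-q.num).toNat) (q.den - 1), ?_⟩
  have h1 : ((q.den - 1 : ℕ) : ℚ) + 1 = q.den := by
    exact_mod_cast Nat.sub_add_cancel q.pos
  have h2 : ((q.num.toNat : ℚ)) - ((-q.num).toNat : ℚ) = q.num := by
    have : ((q.num.toNat : ℤ)) - ((-q.num).toNat : ℤ) = q.num := by omega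
    exact_mod_cast this
  simp only [ratNum, Nat.unpair_pair]
  rw [h1, h2, Rat.num_div_den]

theorem exists_raySum_inf (l l' : List ℕ) : ∃ m, raySum m = raySum l ∩ raySum l' := by
  have hray : ∀ j k, ∃ i, rayNum i = rayNum j ∩ rayNum k := by
    rintro (_ | j) (_ | k)
    · exact ⟨0, by simp [rayNum]⟩
    · exact ⟨k + 1, by simp [rayNum]⟩
    · exact ⟨j + 1, by simp [rayNum]⟩
    · rcases le_total (ratNum j) (ratNum k) with h | h
      · exact ⟨k + 1, by simp [rayNum, Set.Ici_inter_Ici, h]⟩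
      · exact ⟨j + 1, by simp [rayNum, Set.Ici_inter_Ici, h]⟩
  have hdist : ∀ A B C : Set ℚ, symmDiff A B ∩ C = symmDiff (A ∩ C) (B ∩ C) := fun A B C =>
    inf_symmDiff_distrib_right A B C
  have h1 : ∀ j (l : List ℕ), ∃ m, raySum m = raySum l ∩ rayNum j := fun j l => by
    induction l with
    | nil => exact ⟨[], by simp [raySum]⟩
    | cons k l ih =>
      obtain ⟨m, hm⟩ := ih
      obtain ⟨i, hi⟩ := hray k j
      refine ⟨i :: m, ?_⟩
      simp only [raySum, List.foldr_cons] at hm ⊢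
      rw [hdist, hm, hi]
  induction l' with
  | nil => exact ⟨[], by simp [raySum]⟩
  | cons k l' ih =>
    obtain ⟨m, hm⟩ := ih
    obtain ⟨i, hi⟩ := h1 k l
    refine ⟨i ++ m, ?_⟩
    rw [raySum_append, hi, hm, Set.inter_comm _ (rayNum k), Set.inter_comm _ (raySum l'), ← hdist,
      Set.inter_comm]
    rfl

theorem bEtaNum_surjective : Function.Surjective bEtaNum := by
  let R : BooleanSubalgebra (Set ℚ) :=
    { carrier := Set.range raySum
      supClosed' := by
        rintro _ ⟨l, rfl⟩ _ ⟨l', rfl⟩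
        obtain ⟨m, hm⟩ := exists_raySum_inf l l'
        refine ⟨(l ++ l') ++ m, ?_⟩
        rw [raySum_append, raySum_append, hm]
        exact symmDiff_symmDiff_inf _ _
      infClosed' := by
        rintro _ ⟨l, rfl⟩ _ ⟨l', rfl⟩
        exact exists_raySum_inf l l'
      compl_mem' := by
        rintro _ ⟨l, rfl⟩
        exact ⟨0 :: l, top_symmDiff _⟩
      bot_mem' := ⟨[], rfl⟩ }
  have hIci : ∀ a : ℚ, Set.Ici a ∈ R := fun a => by
    obtain ⟨n, rfl⟩ := ratNum_surjective a
    exact ⟨[n + 1], by simp [raySum, rayNum]⟩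
  have hle : BEta ≤ R := by
    refine BooleanSubalgebra.closure_le.2 ?_
    rintro _ ((⟨a, b, rfl⟩ | ⟨a, rfl⟩) | ⟨b, rfl⟩)
    · rw [← Set.Ici_inter_Iio, ← Set.compl_Ici]
      exact BooleanSubalgebra.inf_mem (hIci a) (BooleanSubalgebra.compl_mem (hIci b))
    · exact hIci a
    · rw [← Set.compl_Ici]
      exact BooleanSubalgebra.compl_mem (hIci b)
  rintro ⟨S, hS⟩
  obtain ⟨l, hl⟩ := hle hS
  exact ⟨Encodable.encode l, Subtype.ext (by simp [bEtaNum, hl])⟩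

/-- Comparison of the left endpoints of the rays with numbers `j` and `k`. -/
def rayLe (j k : ℕ) : Prop :=
  j = 0 ∨ k ≠ 0 ∧
    ((j - 1).unpair.1.unpair.1) * ((k - 1).unpair.2 + 1) +
        ((k - 1).unpair.1.unpair.2) * ((j - 1).unpair.2 + 1) ≤
      ((k - 1).unpair.1.unpair.1) * ((j - 1).unpair.2 + 1) +
        ((j - 1).unpair.1.unpair.2) * ((k - 1).unpair.2 + 1)

theorem rayLe_succ (j k : ℕ) : rayLe (j + 1) (k + 1) ↔ ratNum j ≤ ratNum k := by
  have h1 : (0 : ℚ) < (j.unpair.2 : ℚ) + 1 := by positivity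
  have h2 : (0 : ℚ) < (k.unpair.2 : ℚ) + 1 := by positivity
  rw [ratNum, ratNum, div_le_div_iff₀ h1 h2]
  simp only [rayLe, Nat.add_sub_cancel, Nat.succ_ne_zero, false_or, not_false_eq_true, ne_eq,
    true_and]
  rw [← Nat.cast_le (α := ℚ)]
  push_cast
  constructor <;> intro h <;> linarith

theorem rayLe_primrec : PrimrecRel rayLe := by
  have m1 : Primrec fun p : ℕ × ℕ => (p.1 - 1).unpair :=
    Primrec.unpair.comp (Primrec.nat_sub.comp Primrec.fst (Primrec.const 1))
  have m2 : Primrec fun p : ℕ × ℕ => (p.2 - 1).unpair :=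
    Primrec.unpair.comp (Primrec.nat_sub.comp Primrec.snd (Primrec.const 1))
  have a1 := Primrec.unpair.comp (Primrec.fst.comp m1)
  have a2 := Primrec.unpair.comp (Primrec.fst.comp m2)
  have d1 := Primrec.succ.comp (Primrec.snd.comp m1)
  have d2 := Primrec.succ.comp (Primrec.snd.comp m2)
  have hl := Primrec.nat_add.comp (Primrec.nat_mul.comp (Primrec.fst.comp a1) d2)
    (Primrec.nat_mul.comp (Primrec.snd.comp a2) d1)
  have hr := Primrec.nat_add.comp (Primrec.nat_mul.comp (Primrec.fst.comp a2) d1)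
    (Primrec.nat_mul.comp (Primrec.snd.comp a1) d2)
  exact PrimrecPred.or (Primrec.eq.comp Primrec.fst (Primrec.const 0))
    (PrimrecPred.and (PrimrecPred.not (Primrec.eq.comp Primrec.snd (Primrec.const 0)))
      (Primrec.nat_le.comp hl hr))

open Classical in
/-- The parity of the number of rays in `l` that start at or before the start of ray `k`. -/
noncomputable def rayTest (l : List ℕ) (k : ℕ) : Bool :=
  l.foldr (fun j b => xor (decide (rayLe j k)) b) false

open Classical in
theorem mem_raySum (l : List ℕ) (q : ℚ) :
    q ∈ raySum l ↔ l.foldr (fun j b => xor (decide (q ∈ rayNum j)) b) false = true := by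
  induction l with
  | nil => simp [raySum]
  | cons k l ih =>
    simp only [raySum, List.foldr_cons] at ih ⊢
    rw [Set.mem_symmDiff, ih]
    by_cases h : q ∈ rayNum k <;> simp [h]

theorem mem_raySum_iff {l : List ℕ} {q : ℚ} {k : ℕ} (h : ∀ j ∈ l, q ∈ rayNum j ↔ rayLe j k) :
    q ∈ raySum l ↔ rayTest l k = true := by
  classical
  rw [mem_raySum, rayTest]
  induction l with
  | nil => simp
  | cons j l ih =>
    have h1 := h j (by simp)
    have h2 := ih fun i hi => h i (by simp [hi])
    simp only [List.foldr_cons, h1]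
    rw [← Bool.eq_iff_iff] at h2
    convert Iff.rfl using 3
    exact h2.symm

theorem raySum_eq_empty (l : List ℕ) : raySum l = ∅ ↔ ∀ k ∈ l, rayTest l k = false := by
  classical
  constructor
  · intro h k hk
    obtain ⟨q, hq⟩ : ∃ q : ℚ, ∀ j ∈ l, q ∈ rayNum j ↔ rayLe j k := by
      cases k with
      | zero =>
        obtain ⟨q, hq⟩ : ∃ q : ℚ, ∀ j ∈ l, q < ratNum (j - 1) := by
          clear h hk
          induction l with
          | nil => exact ⟨0, by simp⟩
          | cons i l ih =>
            obtain ⟨q, hq⟩ := ih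
            refine ⟨min q (ratNum (i - 1) - 1), fun j hj => ?_⟩
            rcases List.mem_cons.1 hj with rfl | hj
            · exact (min_le_right _ _).trans_lt (by linarith)
            · exact (min_le_left _ _).trans_lt (hq j hj)
        refine ⟨q, fun j hj => ?_⟩
        have := hq j hj
        cases j with
        | zero => simp [rayNum, rayLe]
        | succ j => simpa [rayNum, rayLe] using this
      | succ k =>
        refine ⟨ratNum k, fun j _ => ?_⟩
        cases j with
        | zero => simp [rayNum, rayLe]
        | succ j => rw [rayLe_succ]; rfl
    have := mem_raySum_iff hq
    rw [h] at this
    simpa using this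
  · intro h
    refine Set.eq_empty_iff_forall_notMem.2 fun q hq => ?_
    let e : ℕ → WithBot ℚ := fun k => Nat.casesOn k ⊥ fun n => (ratNum n : WithBot ℚ)
    have he : ∀ j k, rayLe j k ↔ e j ≤ e k := by
      rintro (_ | j) (_ | k)
      · simp [rayLe, e]
      · simp [rayLe, e]
      · simp [rayLe, e]
      · rw [rayLe_succ]; simp [e]
    have hr : ∀ j, q ∈ rayNum j ↔ e j ≤ q := by
      rintro (_ | j) <;> simp [rayNum, e]
    by_cases hne : (l.toFinset.filter fun j => q ∈ rayNum j).Nonempty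
    · obtain ⟨k, hk, hmax⟩ := Finset.exists_max_image _ e hne
      rw [Finset.mem_filter, List.mem_toFinset] at hk
      have := (mem_raySum_iff (l := l) (q := q) (k := k) fun j hj => ?_).1 hq
      · rw [h k hk.1] at this; exact absurd this (by simp)
      · rw [he]
        refine ⟨fun hj' => hmax j (by simp [hj, hj']), fun hj' => ?_⟩
        rw [hr]
        exact hj'.trans ((hr k).1 hk.2)
    · have hno : ∀ j ∈ l, q ∉ rayNum j := fun j hj hj' => hne ⟨j, by simp [hj, hj']⟩
      rw [mem_raySum] at hq
      have : ∀ l : List ℕ, (∀ j ∈ l, q ∉ rayNum j) →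
          l.foldr (fun j b => xor (decide (q ∈ rayNum j)) b) false = false := fun l hl => by
        induction l with
        | nil => rfl
        | cons j l ih =>
          rw [List.foldr_cons, ih fun i hi => hl i (by simp [hi])]
          simp [hl j (by simp)]
      rw [this l hno] at hq
      exact absurd hq (by simp)

theorem exists_eq_bEtaNum :
    ∃ e : ℕ → ℕ → Bool, Computable₂ e ∧ ∀ m n, e m n = true ↔ bEtaNum m = bEtaNum n := by
  classical
  have htest : Primrec₂ rayTest := by
    refine Primrec.list_foldr (f := fun p : List ℕ × ℕ => p.1) (g := fun _ => false)
      (h := fun p q => xor (decide (rayLe q.1 p.2)) q.2) Primrec.fst (Primrec.const _) ?_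
    have h1 : Primrec fun r : (List ℕ × ℕ) × ℕ × Bool => decide (rayLe r.2.1 r.1.2) :=
      PrimrecPred.decide (rayLe_primrec.comp (Primrec.fst.comp Primrec.snd)
        (Primrec.snd.comp Primrec.fst))
    exact (Primrec.dom_bool₂ xor).comp h1 (Primrec.snd.comp Primrec.snd)
  have hrel : PrimrecRel fun (k : ℕ) (l : List ℕ) => rayTest l k = false :=
    Primrec.eq.comp (htest.comp Primrec.snd Primrec.fst) (Primrec.const false)
  have hall : PrimrecPred fun l : List ℕ => ∀ k ∈ l, rayTest l k = false :=
    hrel.forall_mem_list.comp Primrec.id Primrec.id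
  have happ : Primrec fun p : ℕ × ℕ =>
      Denumerable.ofNat (List ℕ) p.1 ++ Denumerable.ofNat (List ℕ) p.2 :=
    Primrec.list_append.comp ((Primrec.ofNat _).comp Primrec.fst)
      ((Primrec.ofNat _).comp Primrec.snd)
  refine ⟨fun m n => decide (∀ k ∈ Denumerable.ofNat (List ℕ) m ++ Denumerable.ofNat (List ℕ) n,
    rayTest (Denumerable.ofNat (List ℕ) m ++ Denumerable.ofNat (List ℕ) n) k = false),
    (PrimrecPred.decide (hall.comp happ)).to_comp, fun m n => ?_⟩
  rw [decide_eq_true_iff, ← raySum_eq_empty, raySum_append, bEtaNum, bEtaNum, Subtype.mk.injEq]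
  exact symmDiff_eq_bot

/-- `Aut_d(B_η)`: the group of `d`-computable automorphisms of the Boolean algebra `B_η`. -/
def AutBEta (d : SetDegree) : Subgroup (BEta ≃o BEta) where
  carrier := {f | MapComputableIn bEtaNum d f}
  mul_mem' hf hg := hf.comp hg
  one_mem' := MapComputableIn.id _ d
  inv_mem' {f} hf := by
    obtain ⟨e, he, heq⟩ := exists_eq_bEtaNum
    exact MapComputableIn.symm bEtaNum_surjective he heq f.toEquiv hf

/-! ### Group embeddings -/

/-- The group `G` embeds in the group `H`. -/
def GroupEmbeds (G H : Type*) [Group G] [Group H] : Prop :=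
  ∃ φ : G →* H, Function.Injective φ

/-! ### Closure properties of relative computability -/

/-! Both equivalences share one argument for the implication from an embedding to `a ≤ b`. In a
group attached to `a`, every set `B` computable in `a` is coded by three elements `t`, `s`, `u` such
that the conjugate of `s` by `t ^ n` commutes with `u` exactly when `n ∈ B` (`CodesSets`). An
injective homomorphism preserves and reflects commutation, so the code survives an arbitrary
embedding, with no effectiveness assumed of it. In a group attached to `b`, each element acts on
numbered objects through some `b`-computable function, and distinctness of these objects is
`b`-enumerable (`IsEffectiveAction`). Three fixed elements need only three such functions, so
failure to commute is `b`-enumerable in `n`. Coding both a set of degree `a` and its complement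
makes both `b`-enumerable, and hence the set `b`-computable (`le_of_groupEmbeds`).

For the lattices, the codes come from permutations of the standard basis; for `B_η`, from piecewise
linear order automorphisms of the rationals. In both cases `s` performs, in block `n`, a local
motion that depends on whether `n ∈ B`, `t ^ n` brings block `n` to block `0`, and `u` tests for
that motion there.

The main difficulty is that an arbitrary automorphism of `L_d(V_∞)`, not assumed computable, acts on
lines by a `d`-computable function (`exists_map_ceLine_vecNum`). The proof avoids semilinear
representations. A computable projection is determined by two complementary enumerable subspaces,
and its action on lines is a lattice expression in them; an automorphism therefore carries it to
another computable projection (`exists_map_projection`). Suitable projections walk from the line of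
one basis vector to all the others, then spread the basis vectors over all vectors of a coordinate
subspace, and finally three coordinate projections determine any line.

The same fact gives the converse for the lattices: when `a ≤ b`, the action on lines extends to all
subspaces and keeps `b`-enumerable ones `b`-enumerable (`latticeAutHom`). For `B_η` the converse is
an inclusion of subgroups. -/

theorem ComputableInDeg.of_eq {d : SetDegree} {f g : ℕ → ℕ} (hf : ComputableInDeg d f)
    (h : ∀ n, f n = g n) : ComputableInDeg d g :=
  funext h ▸ hf

theorem ComputableInDeg.const {d : SetDegree} (k : ℕ) : ComputableInDeg d fun _ => k :=
  .of_computable (Computable.const k)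

theorem ComputableInDeg.id {d : SetDegree} : ComputableInDeg d fun n => n :=
  .of_computable Computable.id

theorem ComputableInDeg.left {d : SetDegree} : ComputableInDeg d fun n => n.unpair.1 :=
  .of_computable (Computable.fst.comp Computable.unpair)

theorem ComputableInDeg.right {d : SetDegree} : ComputableInDeg d fun n => n.unpair.2 :=
  .of_computable (Computable.snd.comp Computable.unpair)

theorem ComputableInDeg.fst {d : SetDegree} {f : ℕ → ℕ} (hf : ComputableInDeg d f) :
    ComputableInDeg d fun n => (f n).unpair.1 :=
  left.comp hf

theorem ComputableInDeg.snd {d : SetDegree} {f : ℕ → ℕ} (hf : ComputableInDeg d f) :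
    ComputableInDeg d fun n => (f n).unpair.2 :=
  right.comp hf

theorem ComputableInDeg.mono {a b : SetDegree} (hab : a ≤ b) {f : ℕ → ℕ}
    (hf : ComputableInDeg a f) : ComputableInDeg b f :=
  le_trans hf hab

theorem ComputableInDeg.prec {d : SetDegree} {f h : ℕ → ℕ} (hf : ComputableInDeg d f)
    (hh : ComputableInDeg d h) :
    ComputableInDeg d fun p => Nat.rec (motive := fun _ => ℕ) (f p.unpair.1)
      (fun y ih => h (Nat.pair p.unpair.1 (Nat.pair y ih))) p.unpair.2 := by
  obtain ⟨_, A, rfl⟩ := d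
  rw [computableInDeg_mk] at *
  refine (Nat.RecursiveIn.prec hf hh).of_eq fun p => ?_
  simp only [PFun.coe_val]
  generalize p.unpair.2 = n
  induction n with
  | zero => rfl
  | succ n ih =>
    simp only [ih]
    exact Part.bind_some _ _

theorem ComputableInDeg.natRec {d : SetDegree} {k f h : ℕ → ℕ} (hk : ComputableInDeg d k)
    (hf : ComputableInDeg d f) (hh : ComputableInDeg d h) :
    ComputableInDeg d fun n => Nat.rec (motive := fun _ => ℕ) (f n)
      (fun y ih => h (Nat.pair n (Nat.pair y ih))) (k n) :=
  ((hf.prec hh).comp (id.pair hk)).of_eq fun n => by simp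

/-- The predicate `P` on the natural numbers is `d`-decidable. -/
def DecidableInDeg (d : SetDegree) (P : ℕ → Prop) : Prop :=
  ∃ c, ComputableInDeg d c ∧ ∀ n, c n = 0 ↔ P n

/-- Truth is the value `0`, the convention of unbounded search, so conjunction is addition and,
below, disjunction is multiplication. -/
theorem DecidableInDeg.and {d : SetDegree} {P Q : ℕ → Prop} (hP : DecidableInDeg d P)
    (hQ : DecidableInDeg d Q) : DecidableInDeg d fun n => P n ∧ Q n := by
  obtain ⟨c, hc, h⟩ := hP
  obtain ⟨c', hc', h'⟩ := hQ
  exact ⟨_, ComputableInDeg.comp₂ Primrec.nat_add.to_comp hc hc', fun n => by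
    simp only [← h, ← h']; exact Nat.add_eq_zero_iff⟩

theorem DecidableInDeg.or {d : SetDegree} {P Q : ℕ → Prop} (hP : DecidableInDeg d P)
    (hQ : DecidableInDeg d Q) : DecidableInDeg d fun n => P n ∨ Q n := by
  obtain ⟨c, hc, h⟩ := hP
  obtain ⟨c', hc', h'⟩ := hQ
  exact ⟨_, ComputableInDeg.comp₂ Primrec.nat_mul.to_comp hc hc', fun n => by
    simp only [← h, ← h']; exact Nat.mul_eq_zero⟩

theorem DecidableInDeg.not {d : SetDegree} {P : ℕ → Prop} (hP : DecidableInDeg d P) :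
    DecidableInDeg d fun n => ¬ P n := by
  obtain ⟨c, hc, h⟩ := hP
  exact ⟨_, ComputableInDeg.comp₂ Primrec.nat_sub.to_comp (.const 1) hc, fun n => by
    simp only [← h]; omega⟩

theorem DecidableInDeg.comp {d : SetDegree} {P : ℕ → Prop} (hP : DecidableInDeg d P) {f : ℕ → ℕ}
    (hf : ComputableInDeg d f) : DecidableInDeg d fun n => P (f n) := by
  obtain ⟨c, hc, h⟩ := hP
  exact ⟨_, hc.comp hf, fun n => h _⟩

theorem DecidableInDeg.congr {d : SetDegree} {P Q : ℕ → Prop} (hP : DecidableInDeg d P)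
    (h : ∀ n, P n ↔ Q n) : DecidableInDeg d Q :=
  funext (fun n => propext (h n)) ▸ hP

theorem DecidableInDeg.of_primrecPred {d : SetDegree} {P : ℕ → Prop} (hP : PrimrecPred P) :
    DecidableInDeg d P := by
  classical
  refine ⟨fun n => if P n then 0 else 1, .of_computable
    (Primrec.ite hP (Primrec.const 0) (Primrec.const 1)).to_comp, fun n => ?_⟩
  by_cases h : P n <;> simp [h]

theorem DecidableInDeg.of_computable₂ {d : SetDegree} {e : ℕ → ℕ → Bool} (he : Computable₂ e)
    {f g : ℕ → ℕ} (hf : ComputableInDeg d f) (hg : ComputableInDeg d g) :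
    DecidableInDeg d fun n => e (f n) (g n) = true := by
  have hc : Computable₂ fun m n : ℕ => bif e m n then 0 else 1 :=
    Computable.cond he (Computable.const 0) (Computable.const 1)
  refine ⟨_, ComputableInDeg.comp₂ hc hf hg, fun n => ?_⟩
  cases h : e (f n) (g n) <;> simp [h]

theorem DecidableInDeg.eq {d : SetDegree} {f g : ℕ → ℕ} (hf : ComputableInDeg d f)
    (hg : ComputableInDeg d g) : DecidableInDeg d fun n => f n = g n :=
  ((of_primrecPred (P := fun n => n.unpair.1 = n.unpair.2) (Primrec.eq.comp
    (Primrec.fst.comp Primrec.unpair) (Primrec.snd.comp Primrec.unpair))).comp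
      (hf.pair hg)).congr fun n => by simp

theorem ComputableInDeg.ite {d : SetDegree} {P : ℕ → Prop} [DecidablePred P] (hP : DecidableInDeg d P) {f g : ℕ → ℕ}
    (hf : ComputableInDeg d f) (hg : ComputableInDeg d g) :
    ComputableInDeg d fun n => if P n then f n else g n := by
  obtain ⟨c, hc, h⟩ := hP
  -- Recursion on the decision value: `0` returns `f n`, and any successor returns `g n`, since the
  -- step ignores the previous value.
  refine (natRec (k := c) (f := f) (h := fun n => g n.unpair.1) hc hf
    (hg.comp left)).of_eq fun n => ?_
  have := h n
  cases hn : c n <;> simp [← this, hn]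

theorem DecidableInDeg.exists_search {d : SetDegree} {P : ℕ → ℕ → Prop}
    (hP : DecidableInDeg d fun n => P n.unpair.1 n.unpair.2) (h : ∀ n, ∃ m, P n m) :
    ∃ g, ComputableInDeg d g ∧ ∀ n, P n (g n) := by
  classical
  obtain ⟨c, hc, hcP⟩ := hP
  refine ⟨fun n => Nat.find (h n), hc.rfind fun n => ?_, fun n => Nat.find_spec (h n)⟩
  refine ⟨?_, fun m hm => ?_⟩
  · rw [hcP]; simpa using Nat.find_spec (h n)
  · rw [Ne, hcP]; simpa using Nat.find_min (h n) hm

theorem ComputableInDeg.listMap {d : SetDegree} {g : ℕ → ℕ} (hg : ComputableInDeg d g) :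
    ComputableInDeg d fun p => Encodable.encode
      ((Denumerable.ofNat (List ℕ) p.unpair.2).map fun x => g (Nat.pair p.unpair.1 x)) := by
  have hget : Computable₂ fun n y : ℕ => ((Denumerable.ofNat (List ℕ) n)[y]?).getD 0 :=
    Computable.option_getD (Computable.list_getElem?.comp
      ((Computable.ofNat _).comp Computable.fst) Computable.snd) (Computable.const 0)
  have hlen : Computable fun n : ℕ => (Denumerable.ofNat (List ℕ) n).length :=
    Computable.list_length.comp (Computable.ofNat _)
  have happ : Computable₂ fun n x : ℕ => Encodable.encode (Denumerable.ofNat (List ℕ) n ++ [x]) :=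
    Computable.encode.comp (Computable.list_concat.comp
      ((Computable.ofNat _).comp Computable.fst) Computable.snd)
  have hstep : ComputableInDeg d fun q => Encodable.encode (Denumerable.ofNat (List ℕ)
      q.unpair.2.unpair.2 ++ [g (Nat.pair q.unpair.1.unpair.1
        (((Denumerable.ofNat (List ℕ) q.unpair.1.unpair.2)[q.unpair.2.unpair.1]?).getD 0))]) :=
    comp₂ happ right.snd (hg.comp (left.fst.pair (comp₂ hget left.snd right.fst)))
  refine (natRec ((of_computable hlen).comp right) (const (Encodable.encode ([] : List ℕ)))
    hstep).of_eq fun p => ?_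
  simp only [Nat.unpair_pair]
  generalize Denumerable.ofNat (List ℕ) p.unpair.2 = l
  -- After `k` steps the accumulator codes the image of the prefix of length `k`; the default `0` is
  -- never read for `k` within the length.
  suffices H : ∀ k ≤ l.length, Nat.rec (motive := fun _ => ℕ) (Encodable.encode ([] : List ℕ))
      (fun y ih => Encodable.encode (Denumerable.ofNat (List ℕ) ih ++
        [g (Nat.pair p.unpair.1 ((l[y]?).getD 0))])) k =
      Encodable.encode ((l.take k).map fun x => g (Nat.pair p.unpair.1 x)) by
    simpa using H l.length le_rfl
  intro k
  induction k with
  | zero => simp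
  | succ k ih =>
    intro hk
    simp only [ih (by omega), Denumerable.ofNat_encode]
    rw [List.take_add_one, List.getElem?_eq_getElem (by omega)]
    simp only [Option.getD_some, Option.toList_some, List.map_append, List.map_cons, List.map_nil]

/-! ### Computing with vectors -/

section Vectors

variable {F : Type*} [Field F] (ν : ComputableField F) (d : SetDegree)

theorem vecNum_surjective : Function.Surjective (vecNum ν) := fun v => by
  choose c hc using ν.surjective
  obtain ⟨N, hN⟩ : ∃ N, ∀ i, N ≤ i → v i = 0 := by
    refine ⟨v.support.sup (fun i => i + 1), fun i hi => ?_⟩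
    by_contra h
    have := Finset.le_sup (f := fun i => i + 1) (Finsupp.mem_support_iff.2 h)
    omega
  refine ⟨Encodable.encode ((List.range N).map fun i => c (v i)), ?_⟩
  rw [vecNum_encode]
  ext i
  simp only [listVec, Finsupp.onFinset_apply, List.getElem?_map]
  by_cases hi : i < N
  · rw [List.getElem?_range hi]; simp [hc]
  · rw [List.getElem?_eq_none (by simpa using hi), hN i (by omega)]; rfl

theorem exists_smul_vecNum : ∃ s : ℕ → ℕ, ComputableInDeg d s ∧
    ∀ c n, vecNum ν (s (Nat.pair c n)) = ν.elt c • vecNum ν n := by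
  obtain ⟨m, hm, hmul⟩ := ν.mul_computable
  refine ⟨_, (ComputableInDeg.comp₂ hm .left .right).listMap, fun c n => ?_⟩
  simp only [Nat.unpair_pair]
  rw [vecNum_encode, vecNum]
  ext i
  simp only [listVec, Finsupp.onFinset_apply, Finsupp.smul_apply, List.getElem?_map]
  cases (Denumerable.ofNat (List ℕ) n)[i]? <;> simp [hmul]

theorem DecidableInDeg.vecNum_eq {d : SetDegree} {f g : ℕ → ℕ} (hf : ComputableInDeg d f)
    (hg : ComputableInDeg d g) : DecidableInDeg d fun n => vecNum ν (f n) = vecNum ν (g n) := by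
  obtain ⟨e, he, heq⟩ := exists_eq_vecNum ν
  exact (DecidableInDeg.of_computable₂ he hf hg).congr fun n => heq _ _

/-- The sequence of vectors `v` is `d`-computable. -/
def VecSeqComputable (v : ℕ → VInf F) : Prop :=
  ∃ g : ℕ → ℕ, ComputableInDeg d g ∧ ∀ n, vecNum ν (g n) = v n

variable {ν d}

theorem VecSeqComputable.comp {v : ℕ → VInf F} (hv : VecSeqComputable ν d v) {f : ℕ → ℕ}
    (hf : ComputableInDeg d f) : VecSeqComputable ν d fun n => v (f n) := by
  obtain ⟨g, hg, h⟩ := hv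
  exact ⟨_, hg.comp hf, fun n => h _⟩

theorem VecSeqComputable.map {v : ℕ → VInf F} (hv : VecSeqComputable ν d v) {T : VInf F → VInf F}
    (hT : MapComputableIn (vecNum ν) d T) : VecSeqComputable ν d fun n => T (v n) := by
  obtain ⟨g, hg, h⟩ := hv
  obtain ⟨t, ht, h'⟩ := hT
  exact ⟨_, ht.comp hg, fun n => by rw [h', h]⟩

theorem vecSeqComputable_vecNum : VecSeqComputable ν d (vecNum ν) :=
  ⟨_, .id, fun _ => rfl⟩

theorem VecSeqComputable.const (v : VInf F) : VecSeqComputable ν d fun _ => v := by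
  obtain ⟨n, hn⟩ := vecNum_surjective ν v
  exact ⟨_, .const n, fun _ => hn⟩

theorem VecSeqComputable.add {v w : ℕ → VInf F} (hv : VecSeqComputable ν d v)
    (hw : VecSeqComputable ν d w) : VecSeqComputable ν d fun n => v n + w n := by
  obtain ⟨g, hg, h⟩ := hv
  obtain ⟨g', hg', h'⟩ := hw
  obtain ⟨a, ha, hadd⟩ := exists_add_vecNum ν
  exact ⟨_, ComputableInDeg.comp₂ ha hg hg', fun n => by rw [hadd, h, h']⟩

theorem VecSeqComputable.smul {c : ℕ → ℕ} {v : ℕ → VInf F} (hc : ComputableInDeg d c)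
    (hv : VecSeqComputable ν d v) : VecSeqComputable ν d fun n => ν.elt (c n) • v n := by
  obtain ⟨g, hg, h⟩ := hv
  obtain ⟨s, hs, hsmul⟩ := exists_smul_vecNum ν d
  exact ⟨_, hs.comp (hc.pair hg), fun n => by rw [hsmul, h]⟩

theorem VecSeqComputable.sub {v w : ℕ → VInf F} (hv : VecSeqComputable ν d v)
    (hw : VecSeqComputable ν d w) : VecSeqComputable ν d fun n => v n - w n := by
  obtain ⟨c, hc⟩ := ν.surjective (-1)
  have := hv.add (.smul (.const c) hw)
  simpa [hc, sub_eq_add_neg] using this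

theorem VecSeqComputable.ite {P : ℕ → Prop} [DecidablePred P] (hP : DecidableInDeg d P) {v w : ℕ → VInf F}
    (hv : VecSeqComputable ν d v) (hw : VecSeqComputable ν d w) :
    VecSeqComputable ν d fun n => if P n then v n else w n := by
  obtain ⟨g, hg, h⟩ := hv
  obtain ⟨g', hg', h'⟩ := hw
  refine ⟨_, ComputableInDeg.ite hP hg hg', fun n => ?_⟩
  by_cases hn : P n <;> simp [hn, h, h']

theorem VecSeqComputable.eq {v w : ℕ → VInf F} (hv : VecSeqComputable ν d v)
    (hw : VecSeqComputable ν d w) : DecidableInDeg d fun n => v n = w n := by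
  obtain ⟨g, hg, h⟩ := hv
  obtain ⟨g', hg', h'⟩ := hw
  exact (DecidableInDeg.vecNum_eq ν hg hg').congr fun n => by rw [h, h']

/-- Primitive recursion for sequences of vectors. -/
theorem VecSeqComputable.iterate {f : ℕ → VInf F → VInf F} (v : VInf F)
    (hf : VecSeqComputable ν d fun n => f n.unpair.1 (vecNum ν n.unpair.2)) :
    VecSeqComputable ν d fun n => Nat.rec (motive := fun _ => VInf F) v (fun y w => f y w) n := by
  obtain ⟨g, hg, h⟩ := hf
  obtain ⟨m, rfl⟩ := vecNum_surjective ν v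
  refine ⟨_, .natRec .id (.const m) (hg.comp .right), fun n => ?_⟩
  induction n with
  | zero => rfl
  | succ n ih => simp only [Nat.unpair_pair, h] at ih ⊢; rw [ih]

theorem VecSeqComputable.single_one :
    VecSeqComputable ν d fun n => (Finsupp.single n 1 : VInf F) := by
  obtain ⟨z, hz⟩ := ν.surjective 0
  obtain ⟨o, ho⟩ := ν.surjective 1
  -- Prepending a zero shifts the coordinates, which turns one basis vector into the next.
  have hc : Computable₂ fun n y : ℕ => Encodable.encode (z :: Denumerable.ofNat (List ℕ) y) :=
    Computable.encode.comp (Computable.list_cons.comp (Computable.const z)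
      ((Computable.ofNat _).comp Computable.snd))
  refine ⟨_, .natRec .id (.const (Encodable.encode [o]))
    (ComputableInDeg.comp₂ hc (.const 0) ComputableInDeg.right.snd), fun n => ?_⟩
  induction n with
  | zero =>
    change vecNum ν (Encodable.encode [o]) = _
    rw [vecNum_encode]
    ext i
    cases i <;> simp [listVec, ho]
  | succ n ih =>
    simp only [vecNum_encode, Nat.unpair_pair] at ih ⊢
    rw [vecNum] at ih
    ext i
    have := DFunLike.congr_fun ih (i - 1)
    simp only [listVec, Finsupp.onFinset_apply] at this ⊢
    cases i with
    | zero => simp [hz]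
    | succ i =>
      rw [List.getElem?_cons_succ]
      simp only [Nat.add_sub_cancel] at this
      rw [this]
      simp [Finsupp.single_apply]

/-- A linear map is computable if it is computable on the standard basis. -/
theorem MapComputableIn.of_basis {T : VInf F →ₗ[F] VInf F}
    (hT : VecSeqComputable ν d fun i => T (Finsupp.single i 1)) :
    MapComputableIn (vecNum ν) d T := by
  obtain ⟨z, hz⟩ := ν.surjective 0
  have hget : Computable₂ fun n y : ℕ => ((Denumerable.ofNat (List ℕ) n)[y]?).getD z :=
    Computable.option_getD (Computable.list_getElem?.comp
      ((Computable.ofNat _).comp Computable.fst) Computable.snd) (Computable.const z)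
  have hlen : Computable fun n : ℕ => (Denumerable.ofNat (List ℕ) n).length :=
    Computable.list_length.comp (Computable.ofNat _)
  obtain ⟨g, hg, h⟩ : VecSeqComputable ν d fun q => vecNum ν q.unpair.2.unpair.2 +
      ν.elt (((Denumerable.ofNat (List ℕ) q.unpair.1)[q.unpair.2.unpair.1]?).getD z) •
        T (Finsupp.single q.unpair.2.unpair.1 1) :=
    (vecSeqComputable_vecNum.comp ComputableInDeg.right.snd).add
      (.smul (ComputableInDeg.comp₂ hget .left ComputableInDeg.right.fst)
        (hT.comp ComputableInDeg.right.fst))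
  obtain ⟨m, hm⟩ := vecNum_surjective ν 0
  refine ⟨_, .natRec (.of_computable hlen) (.const m) hg, fun n => ?_⟩
  -- The coding list supplies the finitely many coordinates in the basis expansion, so by linearity
  -- the image is a sum accumulated along the list.
  have hsum : vecNum ν n = ∑ i ∈ Finset.range (Denumerable.ofNat (List ℕ) n).length,
      ν.elt (((Denumerable.ofNat (List ℕ) n)[i]?).getD z) • (Finsupp.single i 1 : VInf F) := by
    ext i
    simp only [vecNum, listVec, Finsupp.onFinset_apply, Finsupp.finsetSum_apply,
      Finsupp.smul_apply, Finsupp.single_apply, smul_eq_mul, mul_ite, mul_one, mul_zero,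
      Finset.sum_ite_eq', Finset.mem_range]
    split_ifs with hi
    · rw [List.getElem?_eq_getElem hi]; rfl
    · rw [List.getElem?_eq_none (by omega)]; rfl
  rw [hsum, map_sum]
  simp only [map_smul]
  generalize (Denumerable.ofNat (List ℕ) n).length = k
  induction k with
  | zero => simpa using hm
  | succ k ih =>
    rw [Finset.sum_range_succ, ← ih, h]
    simp

end Vectors

/-! ### Automorphisms of `L_d(V_∞)` and projections -/

section Lattice

variable {F : Type*} [Field F] {ν : ComputableField F} {d : SetDegree}

theorem mem_latticeOfCESubspaces_iff {W : Submodule F (VInf F)} :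
    W ∈ LatticeOfCESubspaces ν d ↔ ∃ v, VecSeqComputable ν d v ∧ Set.range v = W := by
  constructor
  · rintro ⟨g, hg, h⟩
    exact ⟨_, ⟨g, hg, fun _ => rfl⟩, h⟩
  · rintro ⟨v, ⟨g, hg, hv⟩, h⟩
    exact ⟨g, hg, by simpa only [hv] using h⟩

/-- The line spanned by `x`, as an element of `L_d(V_∞)`. -/
noncomputable def ceLine (ν : ComputableField F) (d : SetDegree) (x : VInf F) : LatticeOfCESubspaces ν d :=
  ⟨Submodule.span F {x}, mem_latticeOfCESubspaces_iff.2 ⟨fun n => ν.elt n • x,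
    .smul .id (.const x), by
      ext v
      rw [SetLike.mem_coe, Submodule.mem_span_singleton]
      exact (ν.surjective.exists (p := fun c => c • x = v)).symm⟩⟩

theorem ceLine_le {x : VInf F} {W : LatticeOfCESubspaces ν d} : ceLine ν d x ≤ W ↔ x ∈ W.1 :=
  Submodule.span_singleton_le_iff_mem x W.1

theorem mem_ceLine {x y : VInf F} : x ∈ (ceLine ν d y).1 ↔ ∃ c : F, c • y = x :=
  Submodule.mem_span_singleton

theorem self_mem_ceLine (x : VInf F) : x ∈ (ceLine ν d x).1 :=
  Submodule.mem_span_singleton_self x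

theorem ceLine_zero_le (W : LatticeOfCESubspaces ν d) : ceLine ν d 0 ≤ W :=
  ceLine_le.2 W.1.zero_mem

theorem ceLine_eq_of_le {x y : VInf F} (hx : x ≠ 0) (h : ceLine ν d x ≤ ceLine ν d y) :
    ceLine ν d x = ceLine ν d y := by
  refine le_antisymm h (ceLine_le.2 ?_)
  obtain ⟨c, hc⟩ := mem_ceLine.1 (ceLine_le.1 h)
  have hc0 : c ≠ 0 := fun h0 => hx (by rw [← hc, h0, zero_smul])
  exact mem_ceLine.2 ⟨c⁻¹, by rw [← hc, smul_smul, inv_mul_cancel₀ hc0, one_smul]⟩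

theorem ceLine_eq_zero_iff {x : VInf F} : ceLine ν d x = ceLine ν d 0 ↔ x = 0 := by
  refine ⟨fun h => ?_, fun h => by rw [h]⟩
  obtain ⟨c, hc⟩ := mem_ceLine.1 (h ▸ self_mem_ceLine x)
  rw [← hc, smul_zero]

variable (φ : LatticeOfCESubspaces ν d ≃o LatticeOfCESubspaces ν d)

theorem map_ceLine_zero : φ (ceLine ν d 0) = ceLine ν d 0 :=
  le_antisymm (by rw [← φ.le_symm_apply]; exact ceLine_zero_le _) (ceLine_zero_le _)

/-- Nonzero lines are the atoms. For a nonzero `y` in the image of the line of `x`, the preimage of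
the line of `y` is a nonzero part of the line of `x`, hence all of it. -/
theorem exists_map_ceLine (x : VInf F) : ∃ y, φ (ceLine ν d x) = ceLine ν d y := by
  by_cases hx : x = 0
  · exact ⟨0, hx ▸ map_ceLine_zero φ⟩
  obtain ⟨y, hy, hy0⟩ : ∃ y ∈ (φ (ceLine ν d x)).1, y ≠ 0 := by
    refine (Submodule.ne_bot_iff _).1 fun h => hx ?_
    rw [← ceLine_eq_zero_iff (ν := ν) (d := d), ← φ.injective.eq_iff, map_ceLine_zero]
    exact Subtype.ext (h.trans (Submodule.span_zero_singleton F).symm)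
  refine ⟨y, ?_⟩
  have hle : φ.symm (ceLine ν d y) ≤ ceLine ν d x := by
    rw [φ.symm_apply_le]; exact ceLine_le.2 hy
  obtain ⟨z, hz, hz0⟩ : ∃ z ∈ (φ.symm (ceLine ν d y)).1, z ≠ 0 := by
    refine (Submodule.ne_bot_iff _).1 fun h => hy0 ?_
    rw [← ceLine_eq_zero_iff (ν := ν) (d := d), ← φ.symm.injective.eq_iff, map_ceLine_zero]
    exact Subtype.ext (h.trans (Submodule.span_zero_singleton F).symm)
  have h1 : ceLine ν d z ≤ φ.symm (ceLine ν d y) := ceLine_le.2 hz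
  have h2 := ceLine_eq_of_le hz0 (h1.trans hle)
  exact le_antisymm (by rw [← φ.le_symm_apply, ← h2]; exact h1) (ceLine_le.2 hy)

theorem map_ceLine_eq_zero_iff {x y : VInf F} (h : φ (ceLine ν d x) = ceLine ν d y) :
    y = 0 ↔ x = 0 := by
  rw [← ceLine_eq_zero_iff (ν := ν) (d := d), ← h,
    ← ceLine_eq_zero_iff (ν := ν) (d := d) (x := x), ← φ.injective.eq_iff (a := ceLine ν d x),
    map_ceLine_zero]

theorem range_mem_latticeOfCESubspaces {q : VInf F →ₗ[F] VInf F}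
    (hq : MapComputableIn (vecNum ν) d q) : LinearMap.range q ∈ LatticeOfCESubspaces ν d := by
  refine mem_latticeOfCESubspaces_iff.2 ⟨_, vecSeqComputable_vecNum.map hq, ?_⟩
  rw [LinearMap.coe_range]
  exact (vecNum_surjective ν).range_comp q

/-- The kernel of an idempotent is the range of `x - q x`, so it can be enumerated. -/
theorem ker_mem_latticeOfCESubspaces {q : VInf F →ₗ[F] VInf F}
    (hq : MapComputableIn (vecNum ν) d q) (hi : ∀ x, q (q x) = q x) :
    LinearMap.ker q ∈ LatticeOfCESubspaces ν d := by
  refine mem_latticeOfCESubspaces_iff.2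
    ⟨_, vecSeqComputable_vecNum.sub (vecSeqComputable_vecNum.map hq), ?_⟩
  ext v
  rw [SetLike.mem_coe, LinearMap.mem_ker]
  constructor
  · rintro ⟨n, rfl⟩
    simp [hi]
  · intro hv
    obtain ⟨n, rfl⟩ := vecNum_surjective ν v
    exact ⟨n, by simp [hv]⟩

/-- This expresses the action of a projection on lines by joins and meets alone, which is what a
lattice automorphism respects. -/
theorem span_sup_ker_inf_range {q : VInf F →ₗ[F] VInf F} (hi : ∀ x, q (q x) = q x) (x : VInf F) :
    (Submodule.span F {x} ⊔ LinearMap.ker q) ⊓ LinearMap.range q = Submodule.span F {q x} := by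
  ext v
  rw [Submodule.mem_inf, Submodule.mem_sup, Submodule.mem_span_singleton]
  constructor
  · rintro ⟨⟨_, hy, z, hz, rfl⟩, w, hw⟩
    obtain ⟨c, rfl⟩ := Submodule.mem_span_singleton.1 hy
    refine ⟨c, ?_⟩
    have h1 : q (c • x + z) = c • x + z := by rw [← hw, hi]
    rw [map_add, LinearMap.mem_ker.1 hz, add_zero, map_smul] at h1
    exact h1
  · rintro ⟨c, rfl⟩
    refine ⟨⟨c • x, Submodule.smul_mem _ _ (Submodule.mem_span_singleton_self x), c • (q x - x),
      ?_, by rw [smul_sub]; abel⟩, c • x, map_smul _ _ _⟩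
    rw [LinearMap.mem_ker, map_smul, map_sub, hi, sub_self, smul_zero]

/-- A lattice automorphism carries a computable projection to a computable projection. -/
theorem exists_map_projection {q : VInf F →ₗ[F] VInf F} (hq : MapComputableIn (vecNum ν) d q)
    (hi : ∀ x, q (q x) = q x) : ∃ q' : VInf F →ₗ[F] VInf F, MapComputableIn (vecNum ν) d q' ∧
      ∀ x y, φ (ceLine ν d x) = ceLine ν d y → φ (ceLine ν d (q x)) = ceLine ν d (q' y) := by
  let R : LatticeOfCESubspaces ν d := ⟨_, range_mem_latticeOfCESubspaces hq⟩
  let K : LatticeOfCESubspaces ν d := ⟨_, ker_mem_latticeOfCESubspaces hq hi⟩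
  have htop : ∀ x, x ∈ (φ R ⊔ φ K).1 := fun x => by
    rw [← map_sup, ← ceLine_le, ← φ.symm_apply_le]
    intro z _
    change z ∈ LinearMap.range q ⊔ LinearMap.ker q
    refine Submodule.mem_sup.2 ⟨q z, ⟨z, rfl⟩, z - q z, ?_, by abel⟩
    rw [LinearMap.mem_ker, map_sub, hi, sub_self]
  have hbot : φ R ⊓ φ K ≤ ceLine ν d 0 := by
    rw [← map_inf, ← map_ceLine_zero φ, φ.le_iff_le]
    rintro _ ⟨⟨z, rfl⟩, hz⟩
    have hz' : q (q z) = 0 := hz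
    rw [← hi, hz']
    exact self_mem_ceLine 0
  have hcompl : IsCompl (φ R).1 (φ K).1 := by
    refine IsCompl.of_eq (le_bot_iff.1 ?_) (top_le_iff.1 fun x _ => htop x)
    have h : (φ R).1 ⊓ (φ K).1 ≤ Submodule.span F {0} := hbot
    rwa [Submodule.span_zero_singleton] at h
  -- The transported projection is the one whose range and kernel are the images of the old range
  -- and kernel, which have just been shown complementary.
  let q' := (φ R).1.projection (φ K).1 hcompl
  have hi' : ∀ x, q' (q' x) = q' x := fun x => by simp [q']
  refine ⟨q', ?_, fun x y hxy => ?_⟩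
  · obtain ⟨u, hu, hur⟩ := mem_latticeOfCESubspaces_iff.1 (φ R).2
    obtain ⟨w, hw, hwr⟩ := mem_latticeOfCESubspaces_iff.1 (φ K).2
    -- To compute `q'`, search the two enumerations for a decomposition of the given vector; the
    -- component in `φ R` is the value.
    obtain ⟨g, hg, h⟩ := DecidableInDeg.exists_search
      (P := fun n m => u m.unpair.1 + w m.unpair.2 = vecNum ν n)
      (((hu.comp ComputableInDeg.right.fst).add (hw.comp ComputableInDeg.right.snd)).eq
        (vecSeqComputable_vecNum.comp .left)) fun n => by
      obtain ⟨a, ha, b, hb, hab⟩ := Submodule.mem_sup.1 (htop (vecNum ν n))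
      obtain ⟨i, rfl⟩ : a ∈ Set.range u := hur ▸ ha
      obtain ⟨j, rfl⟩ : b ∈ Set.range w := hwr ▸ hb
      exact ⟨Nat.pair i j, by simpa using hab⟩
    obtain ⟨g', hg', h'⟩ := hu.comp hg.fst
    refine ⟨g', hg', fun n => ?_⟩
    have h1 : u (g n).unpair.1 ∈ (φ R).1 := by rw [← SetLike.mem_coe, ← hur]; exact ⟨_, rfl⟩
    have h2 : w (g n).unpair.2 ∈ (φ K).1 := by rw [← SetLike.mem_coe, ← hwr]; exact ⟨_, rfl⟩
    rw [h', ← h n, map_add]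
    simp only [q']
    rw [Submodule.projection_apply_of_mem_left hcompl h1, Submodule.projection_apply_of_mem_right hcompl h2, add_zero]
  · have e1 : ceLine ν d (q x) = (ceLine ν d x ⊔ K) ⊓ R :=
      Subtype.ext (span_sup_ker_inf_range hi x).symm
    have e2 : ceLine ν d (q' y) = (ceLine ν d y ⊔ φ K) ⊓ φ R := by
      refine Subtype.ext ((span_sup_ker_inf_range hi' y).symm.trans ?_)
      rw [Submodule.ker_projection, Submodule.range_projection]
      rfl
    rw [e1, map_inf, map_sup, hxy, e2]

end Lattice

/-! ### Automorphisms of `L_d(V_∞)` act computably on lines -/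

section Lines

variable {F : Type*} [Field F] {ν : ComputableField F} {d : SetDegree}

theorem idempotent_of_basis {q : VInf F →ₗ[F] VInf F}
    (h : ∀ i, q (q (Finsupp.single i 1)) = q (Finsupp.single i 1)) (x : VInf F) :
    q (q x) = q x := by
  have : q.comp q = q := Finsupp.lhom_ext' fun i => LinearMap.ext_ring (h i)
  exact LinearMap.congr_fun this x

/-- The projection that moves the basis vectors of parity `r` to their successors. -/
noncomputable def chainMap (F : Type*) [Field F] (r : ℕ) : VInf F →ₗ[F] VInf F :=
  Finsupp.linearCombination F fun i =>
    if i % 2 = r then Finsupp.single (i + 1) 1 else Finsupp.single i 1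

theorem chainMap_single (r i : ℕ) : chainMap F r (Finsupp.single i 1) =
    if i % 2 = r then Finsupp.single (i + 1) 1 else Finsupp.single i 1 := by
  simp [chainMap]

/-- A successor has the other parity, so the vectors reached are fixed. This is why the walk along
the basis uses two alternating projections. -/
theorem chainMap_idempotent (r : ℕ) (x : VInf F) :
    chainMap F r (chainMap F r x) = chainMap F r x := by
  refine idempotent_of_basis (fun i => ?_) x
  rw [chainMap_single]
  split_ifs with h
  · rw [chainMap_single, if_neg (by omega)]
  · rw [chainMap_single, if_neg h]

theorem decidableInDeg_mod (m r : ℕ) : DecidableInDeg d fun n => n % m = r :=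
  .of_primrecPred (Primrec.eq.comp (Primrec.nat_mod.comp Primrec.id (Primrec.const m))
    (Primrec.const r))

theorem ComputableInDeg.succ : ComputableInDeg d fun n => n + 1 :=
  .of_computable Primrec.succ.to_comp

theorem chainMap_computable (r : ℕ) : MapComputableIn (vecNum ν) d (chainMap F r) := by
  refine .of_basis ?_
  simp only [chainMap_single]
  exact VecSeqComputable.ite (decidableInDeg_mod (d := d) 2 r)
    (VecSeqComputable.single_one.comp .succ) (VecSeqComputable.single_one (ν := ν))

/-- The projection that annihilates the coordinates congruent to `r` modulo `3`. -/
noncomputable def coordProj (F : Type*) [Field F] (r : ℕ) : VInf F →ₗ[F] VInf F :=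
  Finsupp.linearCombination F fun i => if i % 3 = r then 0 else Finsupp.single i 1

theorem coordProj_single (r i : ℕ) : coordProj F r (Finsupp.single i 1) =
    if i % 3 = r then 0 else Finsupp.single i 1 := by
  simp [coordProj]

theorem coordProj_apply (r : ℕ) (x : VInf F) (i : ℕ) :
    coordProj F r x i = if i % 3 = r then 0 else x i := by
  have : (Finsupp.lapply i).comp (coordProj F r) =
      if i % 3 = r then 0 else (Finsupp.lapply i : VInf F →ₗ[F] F) := by
    refine Finsupp.lhom_ext' fun j => LinearMap.ext_ring ?_
    simp only [LinearMap.comp_apply, Finsupp.lsingle_apply, coordProj_single, Finsupp.lapply_apply]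
    by_cases hij : j = i
    · subst hij
      split_ifs <;> simp
    · split_ifs <;> simp [hij]
  have := LinearMap.congr_fun this x
  split_ifs at this ⊢ <;> simpa using this

theorem coordProj_idempotent (r : ℕ) (x : VInf F) :
    coordProj F r (coordProj F r x) = coordProj F r x := by
  ext i
  simp only [coordProj_apply]
  split_ifs <;> rfl

theorem coordProj_computable (r : ℕ) : MapComputableIn (vecNum ν) d (coordProj F r) := by
  refine .of_basis ?_
  simp only [coordProj_single]
  exact VecSeqComputable.ite (decidableInDeg_mod (d := d) 3 r)
    (VecSeqComputable.const 0) (VecSeqComputable.single_one (ν := ν))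

/-- Three residue classes suffice because any two coordinates survive together in one of the three
projections. At a coordinate `j` where `w` is nonzero, the two projections that keep `j` must use
the same scalar, and every coordinate is kept by one of these two. -/
theorem exists_smul_eq_of_coordProj {x w : VInf F}
    (h : ∀ r < 3, ∃ c : F, c • coordProj F r w = coordProj F r x) : ∃ c : F, c • w = x := by
  choose! c hc using h
  have key : ∀ r < 3, ∀ i, i % 3 ≠ r → c r * w i = x i := fun r hr i hi => by
    simpa [coordProj_apply, hi] using DFunLike.congr_fun (hc r hr) i
  by_cases hw : w = 0
  · refine ⟨0, Finsupp.ext fun i => ?_⟩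
    have := key ((i + 1) % 3) (by omega) i (by omega)
    simpa [hw] using this
  obtain ⟨j, hj⟩ := Finsupp.ne_iff.1 hw
  have heq : c ((j + 1) % 3) = c ((j + 2) % 3) := by
    have h1 := key ((j + 1) % 3) (by omega) j (by omega)
    have h2 := key ((j + 2) % 3) (by omega) j (by omega)
    exact mul_right_cancel₀ hj (h1.trans h2.symm)
  refine ⟨c ((j + 1) % 3), Finsupp.ext fun i => ?_⟩
  by_cases hi : i % 3 = (j + 1) % 3
  · rw [heq]
    exact key _ (by omega) i (by omega)
  · exact key _ (by omega) i hi

/-- The projection along a graph over the coordinates congruent to `r` modulo `3` that moves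
the `k`-th of these basis vectors to the `k`-th vector of the complementary subspace. -/
noncomputable def markerMap (ν : ComputableField F) (r : ℕ) : VInf F →ₗ[F] VInf F :=
  Finsupp.linearCombination F fun i =>
    if i % 3 = r then coordProj F r (vecNum ν (i / 3)) else Finsupp.single i 1

theorem markerMap_single (r i : ℕ) : markerMap ν r (Finsupp.single i 1) =
    if i % 3 = r then coordProj F r (vecNum ν (i / 3)) else Finsupp.single i 1 := by
  simp [markerMap]

/-- The vectors with no coordinate in the class `r` are fixed by the marker map, and its values on
the basis are all of this kind; hence it is idempotent. -/
theorem markerMap_coordProj (r : ℕ) (x : VInf F) :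
    markerMap ν r (coordProj F r x) = coordProj F r x := by
  have : (markerMap ν r).comp (coordProj F r) = coordProj F r :=
    Finsupp.lhom_ext' fun i => LinearMap.ext_ring <| by
      simp only [LinearMap.comp_apply, Finsupp.lsingle_apply, coordProj_single]
      split_ifs with h
      · simp
      · rw [markerMap_single, if_neg h]
  exact LinearMap.congr_fun this x

theorem markerMap_idempotent (r : ℕ) (x : VInf F) :
    markerMap ν r (markerMap ν r x) = markerMap ν r x := by
  refine idempotent_of_basis (fun i => ?_) x
  rw [markerMap_single]
  split_ifs with h
  · rw [markerMap_coordProj]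
  · rw [markerMap_single, if_neg h]

theorem markerMap_computable (r : ℕ) : MapComputableIn (vecNum ν) d (markerMap ν r) := by
  refine .of_basis ?_
  simp only [markerMap_single]
  have hdiv : ComputableInDeg d fun n => n / 3 :=
    .of_computable (Primrec.nat_div.comp Primrec.id (Primrec.const 3)).to_comp
  exact VecSeqComputable.ite (decidableInDeg_mod (d := d) 3 r)
    ((vecSeqComputable_vecNum.comp hdiv).map (coordProj_computable r))
    (VecSeqComputable.single_one (ν := ν))

variable (φ : LatticeOfCESubspaces ν d ≃o LatticeOfCESubspaces ν d)

/-- Generators of the images of the lines spanned by the basis vectors can be computed. -/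
theorem exists_map_ceLine_single : ∃ f, VecSeqComputable ν d f ∧
    ∀ n, φ (ceLine ν d (Finsupp.single n 1)) = ceLine ν d (f n) := by
  obtain ⟨q₀, hq₀, h₀⟩ := exists_map_projection φ (chainMap_computable 0) (chainMap_idempotent 0)
  obtain ⟨q₁, hq₁, h₁⟩ := exists_map_projection φ (chainMap_computable 1) (chainMap_idempotent 1)
  obtain ⟨y, hy⟩ := exists_map_ceLine φ (Finsupp.single 0 1)
  have hv := vecSeqComputable_vecNum (ν := ν) (d := d).comp .right
  -- Only the first generator `y` is chosen; each later one is obtained by applying the transported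
  -- chain map for the parity of the current index.
  refine ⟨_, .iterate (f := fun n w => if n % 2 = 0 then q₀ w else q₁ w) y
    (.ite ((decidableInDeg_mod 2 0).comp .left) (hv.map hq₀) (hv.map hq₁)), fun n => ?_⟩
  induction n with
  | zero => exact hy
  | succ n ih =>
    by_cases hn : n % 2 = 0
    · simpa [chainMap_single, hn] using h₀ _ _ ih
    · have hn' : n % 2 = 1 := by omega
      simpa [chainMap_single, hn'] using h₁ _ _ ih

theorem exists_map_ceLine_coordProj {r : ℕ} (hr : r < 3) : ∃ z, VecSeqComputable ν d z ∧
    ∀ n, φ (ceLine ν d (coordProj F r (vecNum ν n))) = ceLine ν d (z n) := by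
  obtain ⟨f, hf, h⟩ := exists_map_ceLine_single φ
  obtain ⟨q, hq, hφ⟩ := exists_map_projection φ (markerMap_computable r) (markerMap_idempotent r)
  have hc : ComputableInDeg d fun n => 3 * n + r :=
    .of_computable (Primrec.nat_add.comp (Primrec.nat_mul.comp (Primrec.const 3) Primrec.id)
      (Primrec.const r)).to_comp
  refine ⟨_, (hf.comp hc).map hq, fun n => ?_⟩
  -- The basis vector with index `3 * n + r` is the marker sent to the projection of the `n`-th
  -- vector, so its known image line yields the wanted one.
  rw [← hφ _ _ (h _), markerMap_single, if_pos (by omega)]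
  congr 4
  omega

/-- Every automorphism of `L_d(V_∞)` acts on the lines of `V_∞` by a `d`-computable function. -/
theorem exists_map_ceLine_vecNum : ∃ g : ℕ → ℕ, ComputableInDeg d g ∧
    ∀ n, φ (ceLine ν d (vecNum ν n)) = ceLine ν d (vecNum ν (g n)) := by
  have H : ∀ r : Fin 3, ∃ (z : ℕ → VInf F) (q : VInf F →ₗ[F] VInf F), VecSeqComputable ν d z ∧
      (∀ n, φ (ceLine ν d (coordProj F r (vecNum ν n))) = ceLine ν d (z n)) ∧
      MapComputableIn (vecNum ν) d q ∧ ∀ x y, φ (ceLine ν d x) = ceLine ν d y →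
        φ (ceLine ν d (coordProj F r x)) = ceLine ν d (q y) := fun r => by
    obtain ⟨z, hz, h⟩ := exists_map_ceLine_coordProj φ r.2
    obtain ⟨q, hq, h'⟩ := exists_map_projection φ (coordProj_computable r) (coordProj_idempotent r)
    exact ⟨z, q, hz, h, hq, h'⟩
  choose z q hz h hq h' using H
  let P : ℕ → ℕ → ℕ → Fin 3 → Prop := fun n m c r =>
    q r (vecNum ν m) = ν.elt c • z r n
  -- The search runs over a candidate generator together with three scalars, so that each line
  -- membership becomes a decidable equation. The last clause rules out the zero candidate for a
  -- nonzero vector, since zero passes the three tests trivially.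
  obtain ⟨g, hg, hP⟩ := DecidableInDeg.exists_search (d := d) (P := fun n m =>
      (P n m.unpair.1 m.unpair.2.unpair.1 0 ∧ P n m.unpair.1 m.unpair.2.unpair.2.unpair.1 1 ∧
        P n m.unpair.1 m.unpair.2.unpair.2.unpair.2 2) ∧
      (vecNum ν m.unpair.1 = 0 → vecNum ν n = 0)) (by
    have hm := ComputableInDeg.right (d := d)
    have hd : ∀ r c, ComputableInDeg d c →
        DecidableInDeg d fun n => P n.unpair.1 n.unpair.2.unpair.1 (c n) r := fun r c hc =>
      (((vecSeqComputable_vecNum.comp hm.fst).map (hq r))).eq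
        (.smul hc ((hz r).comp .left))
    refine ((hd 0 _ hm.snd.fst).and ((hd 1 _ hm.snd.snd.fst).and (hd 2 _ hm.snd.snd.snd))).and ?_
    exact ((((vecSeqComputable_vecNum (ν := ν)).comp hm.fst).eq (.const 0)).not.or
      (((vecSeqComputable_vecNum (ν := ν)).comp ComputableInDeg.left).eq (.const 0))).congr
      fun n => imp_iff_not_or.symm) fun n => by
    obtain ⟨y, hy⟩ := exists_map_ceLine φ (vecNum ν n)
    obtain ⟨m, rfl⟩ := vecNum_surjective ν y
    have hc : ∀ r, ∃ c, P n m c r := fun r => by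
      obtain ⟨c, hc⟩ := mem_ceLine.1 (((h' r _ _ hy).symm.trans (h r n)) ▸ self_mem_ceLine _)
      obtain ⟨k, rfl⟩ := ν.surjective c
      exact ⟨k, hc.symm⟩
    choose c hc using hc
    refine ⟨Nat.pair m (Nat.pair (c 0) (Nat.pair (c 1) (c 2))), ?_⟩
    simp only [Nat.unpair_pair]
    exact ⟨⟨hc 0, hc 1, hc 2⟩, (map_ceLine_eq_zero_iff φ hy).1⟩
  refine ⟨_, hg.fst, fun n => ?_⟩
  obtain ⟨⟨p0, p1, p2⟩, hne⟩ := hP n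
  -- To verify the candidate, pull its line back to the line of some `x`: the three tests then say
  -- that each projection of `x` is a multiple of that of the given vector.
  obtain ⟨x, hx⟩ := exists_map_ceLine φ.symm (vecNum ν (g n).unpair.1)
  rw [φ.symm_apply_eq, eq_comm] at hx
  have hr : ∀ r : Fin 3, (∃ c, P n (g n).unpair.1 c r) →
      ∃ c : F, c • coordProj F r (vecNum ν n) = coordProj F r x := fun r ⟨c, hc⟩ => by
    rw [← mem_ceLine (ν := ν) (d := d), ← ceLine_le, ← φ.le_iff_le, h' r _ _ hx, h r, hc]
    exact ceLine_le.2 (mem_ceLine.2 ⟨_, rfl⟩)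
  have hx' := exists_smul_eq_of_coordProj (x := x) (w := vecNum ν n) fun r hr3 => by
    interval_cases r
    exacts [hr 0 ⟨_, p0⟩, hr 1 ⟨_, p1⟩, hr 2 ⟨_, p2⟩]
  rw [← hx]
  congr 1
  by_cases hx0 : x = 0
  · rw [hne ((map_ceLine_eq_zero_iff φ hx).2 hx0), hx0]
  · exact (ceLine_eq_of_le hx0 (ceLine_le.2 (mem_ceLine.2 hx'))).symm

end Lines

/-! ### Embeddings induced by comparison of degrees -/

section Extension

variable {F : Type*} [Field F] {ν : ComputableField F} {d : SetDegree}

/-- The action on all subspaces of `V_∞` of an automorphism of `L_d(V_∞)`. -/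
def mapSubspace (φ : LatticeOfCESubspaces ν d ≃o LatticeOfCESubspaces ν d)
    (W : Submodule F (VInf F)) : Submodule F (VInf F) where
  -- `W` need not lie in `L_d`, so `φ` cannot be applied to it; testing the preimages of lines
  -- avoids this. Closure under addition holds because the line of a sum lies below the join of the
  -- two lines.
  carrier := {v | (φ.symm (ceLine ν d v)).1 ≤ W}
  zero_mem' := by
    rw [Set.mem_ofPred_eq, map_ceLine_zero]
    exact Submodule.span_singleton_le_iff_mem _ _ |>.2 W.zero_mem
  add_mem' {v w} hv hw := by
    have h : ceLine ν d (v + w) ≤ ceLine ν d v ⊔ ceLine ν d w := ceLine_le.2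
      (Submodule.add_mem_sup (self_mem_ceLine (ν := ν) (d := d) v) (self_mem_ceLine w))
    have h' := φ.symm.monotone h
    rw [map_sup] at h'
    exact le_trans (show (φ.symm (ceLine ν d (v + w))).1 ≤ _ from h') (sup_le hv hw)
  smul_mem' c v hv := by
    have h : ceLine ν d (c • v) ≤ ceLine ν d v := ceLine_le.2 (mem_ceLine.2 ⟨c, rfl⟩)
    exact le_trans (show (φ.symm (ceLine ν d (c • v))).1 ≤ _ from φ.symm.monotone h) hv

theorem mem_mapSubspace {φ : LatticeOfCESubspaces ν d ≃o LatticeOfCESubspaces ν d}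
    {W : Submodule F (VInf F)} {v : VInf F} :
    v ∈ mapSubspace φ W ↔ (φ.symm (ceLine ν d v)).1 ≤ W := Iff.rfl

/-- The image is the union of the images of the lines in `W`; this existential form is the one that
can be enumerated. -/
theorem mem_mapSubspace_iff_exists {φ : LatticeOfCESubspaces ν d ≃o LatticeOfCESubspaces ν d}
    {W : Submodule F (VInf F)} {v : VInf F} :
    v ∈ mapSubspace φ W ↔ ∃ w ∈ W, v ∈ (φ (ceLine ν d w)).1 := by
  rw [mem_mapSubspace]
  constructor
  · intro h
    obtain ⟨x, hx⟩ := exists_map_ceLine φ.symm v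
    refine ⟨x, h (hx ▸ self_mem_ceLine x), ?_⟩
    rw [← hx, φ.apply_symm_apply]
    exact self_mem_ceLine v
  · rintro ⟨w, hw, hv⟩
    rw [← ceLine_le, ← φ.symm_apply_le] at hv
    exact le_trans (show (φ.symm (ceLine ν d v)).1 ≤ _ from hv)
      ((Submodule.span_singleton_le_iff_mem _ _).2 hw)

theorem mapSubspace_mono (φ : LatticeOfCESubspaces ν d ≃o LatticeOfCESubspaces ν d)
    {W W' : Submodule F (VInf F)} (h : W ≤ W') : mapSubspace φ W ≤ mapSubspace φ W' :=
  fun _ hv => le_trans (mem_mapSubspace.1 hv) h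

theorem mapSubspace_one (W : Submodule F (VInf F)) :
    mapSubspace (1 : LatticeOfCESubspaces ν d ≃o LatticeOfCESubspaces ν d) W = W := by
  ext v
  exact Submodule.span_singleton_le_iff_mem _ _

theorem mapSubspace_mul (φ ψ : LatticeOfCESubspaces ν d ≃o LatticeOfCESubspaces ν d)
    (W : Submodule F (VInf F)) : mapSubspace (φ * ψ) W = mapSubspace φ (mapSubspace ψ W) := by
  ext v
  obtain ⟨x, hx⟩ := exists_map_ceLine φ.symm v
  have h : (φ * ψ).symm (ceLine ν d v) = ψ.symm (φ.symm (ceLine ν d v)) := rfl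
  rw [mem_mapSubspace, mem_mapSubspace, h, hx, ← mem_mapSubspace]
  exact (Submodule.span_singleton_le_iff_mem _ _).symm

theorem mapSubspace_inv_mapSubspace (φ : LatticeOfCESubspaces ν d ≃o LatticeOfCESubspaces ν d)
    (W : Submodule F (VInf F)) : mapSubspace φ⁻¹ (mapSubspace φ W) = W := by
  rw [← mapSubspace_mul, inv_mul_cancel, mapSubspace_one]

/-- Enumerate `W`, replace each vector by a generator of its image line, and list all scalar
multiples. The function on generators is `d`-computable, hence `b`-computable. -/
theorem mapSubspace_mem {b : SetDegree} (hdb : d ≤ b)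
    (φ : LatticeOfCESubspaces ν d ≃o LatticeOfCESubspaces ν d) {W : Submodule F (VInf F)}
    (hW : W ∈ LatticeOfCESubspaces ν b) : mapSubspace φ W ∈ LatticeOfCESubspaces ν b := by
  obtain ⟨g, hg, h⟩ := exists_map_ceLine_vecNum φ
  obtain ⟨k, hk, hr⟩ := hW
  refine mem_latticeOfCESubspaces_iff.2 ⟨fun n => ν.elt n.unpair.1 • vecNum ν (g (k n.unpair.2)),
    .smul .left (vecSeqComputable_vecNum.comp (((hg.mono hdb).comp hk).comp .right)), ?_⟩
  ext v
  rw [SetLike.mem_coe, mem_mapSubspace_iff_exists]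
  constructor
  · rintro ⟨n, rfl⟩
    refine ⟨vecNum ν (k n.unpair.2), ?_, ?_⟩
    · rw [← SetLike.mem_coe, ← hr]; exact ⟨_, rfl⟩
    · rw [h]; exact mem_ceLine.2 ⟨_, rfl⟩
  · rintro ⟨w, hw, hv⟩
    rw [← SetLike.mem_coe, ← hr] at hw
    obtain ⟨i, rfl⟩ := hw
    rw [h, mem_ceLine] at hv
    obtain ⟨c, rfl⟩ := hv
    obtain ⟨j, rfl⟩ := ν.surjective c
    exact ⟨Nat.pair j i, by simp⟩

/-- The homomorphism from the automorphisms of `L_a(V_∞)` to those of `L_b(V_∞)` for `a ≤ b`. -/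
def latticeAutHom (ν : ComputableField F) {a b : SetDegree} (hab : a ≤ b) :
    (LatticeOfCESubspaces ν a ≃o LatticeOfCESubspaces ν a) →*
      (LatticeOfCESubspaces ν b ≃o LatticeOfCESubspaces ν b) where
  toFun φ :=
    { toFun := fun W => ⟨mapSubspace φ W, mapSubspace_mem hab φ W.2⟩
      invFun := fun W => ⟨mapSubspace φ⁻¹ W, mapSubspace_mem hab φ⁻¹ W.2⟩
      left_inv := fun W => Subtype.ext (mapSubspace_inv_mapSubspace φ _)
      right_inv := fun W => Subtype.ext <| by
        simpa using mapSubspace_inv_mapSubspace φ⁻¹ W.1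
      map_rel_iff' := fun {W W'} => by
        refine ⟨fun h => ?_, fun h => mapSubspace_mono φ h⟩
        have := mapSubspace_mono φ⁻¹ (show mapSubspace φ W.1 ≤ mapSubspace φ W'.1 from h)
        rwa [mapSubspace_inv_mapSubspace, mapSubspace_inv_mapSubspace] at this }
  map_one' := RelIso.ext fun W => Subtype.ext (mapSubspace_one _)
  map_mul' φ ψ := RelIso.ext fun W => Subtype.ext (mapSubspace_mul φ ψ _)

/-- An automorphism is determined by its action on the lines. -/
theorem latticeAut_ext {φ ψ : LatticeOfCESubspaces ν d ≃o LatticeOfCESubspaces ν d}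
    (h : ∀ x, φ (ceLine ν d x) = ψ (ceLine ν d x)) : φ = ψ := by
  have hle : ∀ φ ψ : LatticeOfCESubspaces ν d ≃o LatticeOfCESubspaces ν d,
      (∀ x, φ (ceLine ν d x) = ψ (ceLine ν d x)) → ∀ W, φ W ≤ ψ W := fun φ ψ h W y hy => by
    obtain ⟨x, hx⟩ := exists_map_ceLine φ.symm y
    rw [φ.symm_apply_eq] at hx
    change y ∈ (φ W).1 at hy
    rw [← ceLine_le, hx, φ.le_iff_le] at hy
    rw [← ceLine_le, hx, h, ψ.le_iff_le]
    exact hy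
  exact RelIso.ext fun W => le_antisymm (hle φ ψ h W) (hle ψ φ (fun x => (h x).symm) W)

/-- Lines belong to every `L_b`, so an automorphism with trivial extension fixes every line. -/
theorem latticeAutHom_injective (ν : ComputableField F) {a b : SetDegree} (hab : a ≤ b) :
    Function.Injective (latticeAutHom ν hab) := by
  refine (injective_iff_map_eq_one _).2 fun φ hφ => latticeAut_ext fun x => ?_
  obtain ⟨y, hy⟩ := exists_map_ceLine φ x
  have h1 : mapSubspace φ (ceLine ν b x).1 = (ceLine ν b x).1 :=
    congrArg Subtype.val (DFunLike.congr_fun hφ (ceLine ν b x))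
  have h2 : y ∈ (ceLine ν b x).1 := by
    rw [← h1, mem_mapSubspace_iff_exists]
    exact ⟨x, self_mem_ceLine x, hy ▸ self_mem_ceLine y⟩
  change _ = ceLine ν a x
  rw [hy]
  by_cases hy0 : y = 0
  · rw [hy0, (map_ceLine_eq_zero_iff φ hy).1 hy0]
  · exact ceLine_eq_of_le hy0 (ceLine_le.2 h2)

end Extension

theorem AutBEta_mono {a b : SetDegree} (hab : a ≤ b) : AutBEta a ≤ AutBEta b := by
  rintro f ⟨g, hg, h⟩
  exact ⟨g, hg.mono hab, h⟩

/-! ### Coding sets of natural numbers into groups -/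

/-- The group `G` acts faithfully on the elements numbered by `ν`, each group element acts
by a `d`-computable function on the numbers, and inequality of the numbered elements is
`d`-computably enumerable. -/
structure IsEffectiveAction (d : SetDegree) (G : Type*) {X : Type*} [Group G] [MulAction G X]
    (ν : ℕ → X) : Prop where
  faithful : ∀ g h : G, (∀ n, g • ν n = h • ν n) → g = h
  computable : ∀ g : G, ∃ f, ComputableInDeg d f ∧ ∀ n, ν (f n) = g • ν n
  ne_enumerable : ∃ P : ℕ → ℕ → ℕ → Prop,
    DecidableInDeg d (fun q => P q.unpair.1 q.unpair.2.unpair.1 q.unpair.2.unpair.2) ∧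
      ∀ m n, ν m ≠ ν n ↔ ∃ k, P m n k

/-- The subsets of the natural numbers computable in `d` are coded by triples of elements of `G`. -/
def CodesSets (d : SetDegree) (G : Type*) [Group G] : Prop :=
  ∀ B : Set ℕ, ComputableInDeg d (charFun B) →
    ∃ t s u : G, ∀ n : ℕ, Commute ((t ^ n)⁻¹ * s * t ^ n) u ↔ n ∈ B

theorem CodesSets.map {d : SetDegree} {G H : Type*} [Group G] [Group H] (h : CodesSets d G)
    (φ : G →* H) (hφ : Function.Injective φ) : CodesSets d H := fun B hB => by
  obtain ⟨t, s, u, H⟩ := h B hB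
  refine ⟨φ t, φ s, φ u, fun n => ?_⟩
  rw [← H, ← map_pow, ← map_inv, ← map_mul, ← map_mul]
  exact ⟨fun h => h.of_map hφ, fun h => h.map φ⟩

/-- By faithfulness, a failure to commute is visible at some numbered point, and a stage of the
enumeration confirms that the two images differ. Powers of `t` and of its inverse are computed
uniformly in `n` by iterating one function for each. -/
theorem IsEffectiveAction.exists_not_commute_iff {d : SetDegree} {G X : Type*} [Group G]
    [MulAction G X] {ν : ℕ → X} (h : IsEffectiveAction d G ν) (t s u : G) :
    ∃ P : ℕ → ℕ → Prop, DecidableInDeg d (fun q => P q.unpair.1 q.unpair.2) ∧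
      ∀ n : ℕ, ¬ Commute ((t ^ n)⁻¹ * s * t ^ n) u ↔ ∃ m, P n m := by
  have hpow : ∀ g : G, ∃ f, ComputableInDeg d f ∧ ∀ n x, ν (f (Nat.pair n x)) = g ^ n • ν x := by
    intro g
    obtain ⟨f, hf, hfν⟩ := h.computable g
    refine ⟨_, .natRec .left .right (hf.comp ComputableInDeg.right.snd), fun n x => ?_⟩
    simp only [Nat.unpair_pair]
    induction n with
    | zero => simp
    | succ n ih => simp only [hfν, ih, pow_succ', mul_smul]
  obtain ⟨ft, hft, ht⟩ := hpow t
  obtain ⟨fi, hfi, hi⟩ := hpow t⁻¹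
  obtain ⟨fs, hfs, hs⟩ := h.computable s
  obtain ⟨fu, hfu, hu⟩ := h.computable u
  obtain ⟨P, hP, hν⟩ := h.ne_enumerable
  let c : ℕ → ℕ := fun p => fi (Nat.pair p.unpair.1 (fs (ft p)))
  have hc : ComputableInDeg d c := hfi.comp (.pair .left (hfs.comp hft))
  have hcν : ∀ n x, ν (c (Nat.pair n x)) = ((t ^ n)⁻¹ * s * t ^ n) • ν x := fun n x => by
    simp only [c, Nat.unpair_pair, hi, hs, ht, mul_smul, inv_pow]
  refine ⟨fun n m => P (c (Nat.pair n (fu m.unpair.1))) (fu (c (Nat.pair n m.unpair.1))) m.unpair.2,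
    ?_, fun n => ?_⟩
  · have hr := ComputableInDeg.right (d := d)
    have hA := hc.comp (ComputableInDeg.left.pair (hfu.comp hr.fst))
    have hB := hfu.comp (hc.comp (ComputableInDeg.left.pair hr.fst))
    exact (hP.comp (hA.pair (hB.pair hr.snd))).congr fun q => by simp
  · constructor
    · intro hn
      obtain ⟨x, hx⟩ : ∃ x, ((t ^ n)⁻¹ * s * t ^ n * u) • ν x ≠
          (u * ((t ^ n)⁻¹ * s * t ^ n)) • ν x := by
        by_contra! hx
        exact hn (h.faithful _ _ hx)
      rw [mul_smul _ u, mul_smul u, ← hu, ← hcν, ← hcν, ← hu, hν] at hx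
      obtain ⟨k, hk⟩ := hx
      exact ⟨Nat.pair x k, by simpa using hk⟩
    · rintro ⟨m, hm⟩ hn
      refine (hν _ _).2 ⟨_, hm⟩ ?_
      rw [hcν, hu, hu, hcν, ← mul_smul, ← mul_smul, hn.eq]

theorem charFun_compl (A : Set ℕ) (n : ℕ) : charFun Aᶜ n = 1 - charFun A n := by
  by_cases h : n ∈ A <;> simp [charFun, h]

/-- Non-commutation makes only the complement of a coded set enumerable; applying this to `A` and to
its complement gives both halves of a decision procedure. -/
theorem le_of_groupEmbeds {a b : SetDegree} {G H X : Type*} [Group G] [Group H] [MulAction H X]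
    {ν : ℕ → X} (hG : CodesSets a G) (hH : IsEffectiveAction b H ν) (h : GroupEmbeds G H) :
    a ≤ b := by
  obtain ⟨φ, hφ⟩ := h
  have key : ∀ B : Set ℕ, ComputableInDeg a (charFun B) → ∃ P : ℕ → ℕ → Prop,
      DecidableInDeg b (fun q => P q.unpair.1 q.unpair.2) ∧ ∀ n, n ∉ B ↔ ∃ m, P n m := by
    intro B hB
    obtain ⟨t, s, u, hB'⟩ := hG.map φ.rangeRestrict (fun x y hxy => hφ (congrArg Subtype.val hxy))
      B hB
    obtain ⟨P, hP, h⟩ := hH.exists_not_commute_iff t.1 s.1 u.1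
    refine ⟨P, hP, fun n => ?_⟩
    rw [← h, ← hB', not_iff_not]
    exact Subtype.ext_iff
  obtain ⟨_, A, rfl⟩ := a
  have hA : ComputableInDeg ⟨degOf (charFun A : ℕ →. ℕ), A, rfl⟩ (charFun A) := le_rfl
  obtain ⟨P, hP, hPA⟩ := key A hA
  obtain ⟨Q, hQ, hQA⟩ := key Aᶜ ((ComputableInDeg.comp₂ Primrec.nat_sub.to_comp
    (.const 1) hA).of_eq fun n => (charFun_compl A n).symm)
  have hr := ComputableInDeg.right (d := b)
  -- The tag `0` accompanies evidence for `n ∉ A` and the tag `1` evidence for `n ∈ A`, so the tag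
  -- found is the value of the characteristic function.
  obtain ⟨g, hg, h⟩ := DecidableInDeg.exists_search (d := b)
    (P := fun n m => (m.unpair.1 = 0 ∧ P n m.unpair.2) ∨ (m.unpair.1 = 1 ∧ Q n m.unpair.2))
    (((DecidableInDeg.eq hr.fst (.const 0)).and
      ((hP.comp (ComputableInDeg.left.pair hr.snd)).congr fun q => by
        rw [Nat.unpair_pair])).or
      ((DecidableInDeg.eq hr.fst (.const 1)).and
      ((hQ.comp (ComputableInDeg.left.pair hr.snd)).congr fun q => by
        rw [Nat.unpair_pair]))) fun n => by
    by_cases hn : n ∈ A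
    · obtain ⟨m, hm⟩ := (hQA n).1 (not_not.2 hn)
      exact ⟨Nat.pair 1 m, by simpa using hm⟩
    · obtain ⟨m, hm⟩ := (hPA n).1 hn
      exact ⟨Nat.pair 0 m, by simpa using hm⟩
  refine hg.fst.of_eq fun n => ?_
  rcases h n with ⟨h0, hm⟩ | ⟨h1, hm⟩
  · have : n ∉ A := (hPA n).2 ⟨_, hm⟩
    simp [charFun, this, h0]
  · have : n ∈ A := not_not.1 ((hQA n).2 ⟨_, hm⟩)
    simp [charFun, this, h1]

/-! ### Effective actions -/

theorem isEffectiveAction_latticeAut {F : Type*} [Field F] (ν : ComputableField F)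
    (d : SetDegree) : IsEffectiveAction d (LatticeOfCESubspaces ν d ≃o LatticeOfCESubspaces ν d)
      fun n => ceLine ν d (vecNum ν n) where
  faithful g h H := latticeAut_ext fun x => by
    obtain ⟨n, rfl⟩ := vecNum_surjective ν x
    exact H n
  computable g := by
    obtain ⟨f, hf, h⟩ := exists_map_ceLine_vecNum g
    exact ⟨f, hf, fun n => (h n).symm⟩
  ne_enumerable := by
    obtain ⟨z, hz⟩ := ν.surjective 0
    have hget : Computable₂ fun n y : ℕ => ((Denumerable.ofNat (List ℕ) n)[y]?).getD z :=
      Computable.option_getD (Computable.list_getElem?.comp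
        ((Computable.ofNat _).comp Computable.fst) Computable.snd) (Computable.const z)
    have hcoord : ∀ n k, vecNum ν n k =
        ν.elt (((Denumerable.ofNat (List ℕ) n)[k]?).getD z) := fun n k => by
      simp only [vecNum, listVec, Finsupp.onFinset_apply]
      cases (Denumerable.ofNat (List ℕ) n)[k]? <;> simp [hz]
    -- Nonzero vectors span different lines when some cross-multiplication fails. If one vector is
    -- zero, every cross-multiplication holds, so the case where exactly one vanishes is listed
    -- separately.
    refine ⟨fun m n k => (¬ vecNum ν m k • vecNum ν n = vecNum ν n k • vecNum ν m) ∨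
      ((vecNum ν m = 0 ∧ ¬ vecNum ν n = 0) ∨ (¬ vecNum ν m = 0 ∧ vecNum ν n = 0)), ?_,
      fun m n => ⟨fun hne => ?_, ?_⟩⟩
    · have hr := ComputableInDeg.right (d := d)
      have hm := (vecSeqComputable_vecNum (ν := ν)).comp (ComputableInDeg.left (d := d))
      have hn := (vecSeqComputable_vecNum (ν := ν)).comp hr.fst
      have h1 := hm.eq (.const 0)
      have h2 := hn.eq (.const 0)
      simp only [hcoord]
      exact (((VecSeqComputable.smul (ComputableInDeg.comp₂ hget .left hr.snd) hn).eq
        (.smul (ComputableInDeg.comp₂ hget hr.fst hr.snd) hm)).not).or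
        ((h1.and h2.not).or (h1.not.and h2))
    · by_contra! H
      have hmn : vecNum ν m = 0 → vecNum ν n = 0 := (H 0).2.1
      have hnm : vecNum ν m ≠ 0 → vecNum ν n ≠ 0 := (H 0).2.2
      by_cases h0 : vecNum ν m = 0
      · exact hne (by rw [h0, hmn h0])
      obtain ⟨k, hk⟩ := Finsupp.ne_iff.1 h0
      refine hne (ceLine_eq_of_le (hnm h0) (ceLine_le.2 (mem_ceLine.2
        ⟨(vecNum ν m k)⁻¹ * vecNum ν n k, ?_⟩))).symm
      rw [mul_smul, ← (H k).1, smul_smul, inv_mul_cancel₀ hk, one_smul]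
    · rintro ⟨k, hk⟩ heq
      have h0 : vecNum ν m = 0 ↔ vecNum ν n = 0 := by
        rw [← ceLine_eq_zero_iff (ν := ν) (d := d), heq, ceLine_eq_zero_iff]
      obtain ⟨c, hc⟩ := mem_ceLine.1 (heq ▸ self_mem_ceLine (ν := ν) (d := d) (vecNum ν m))
      rcases hk with hk | hk
      · refine hk ?_
        rw [← hc, Finsupp.smul_apply, smul_smul, smul_eq_mul, mul_comm]
      · tauto

theorem isEffectiveAction_autBEta (d : SetDegree) : IsEffectiveAction d (AutBEta d) bEtaNum where
  faithful g h H := Subtype.ext <| RelIso.ext fun x => by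
    obtain ⟨n, rfl⟩ := bEtaNum_surjective x
    exact H n
  computable g := g.2
  ne_enumerable := by
    obtain ⟨e, he, h⟩ := exists_eq_bEtaNum
    exact ⟨fun m n _ => ¬ e m n = true, (DecidableInDeg.of_computable₂ he .left
      ComputableInDeg.right.fst).not, fun m n => by
      rw [Ne, ← h]; exact (exists_const ℕ).symm⟩

/-! ### Coding by permutations of the basis -/

/-- The group of `d`-computable permutations of the natural numbers. -/
def computablePerm (d : SetDegree) : Subgroup (Equiv.Perm ℕ) where
  carrier := {f | MapComputableIn (fun n => n) d f}
  mul_mem' hf hg := MapComputableIn.comp (ν := fun n : ℕ => n) hf hg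
  one_mem' := MapComputableIn.id (fun n : ℕ => n) d
  inv_mem' {f} hf := MapComputableIn.symm (ν := fun n : ℕ => n) (e := fun m n => decide (m = n))
    Function.surjective_id (PrimrecPred.decide Primrec.eq).to_comp (by simp) f hf

theorem ComputableInDeg.mem_computablePerm {d : SetDegree} {f : Equiv.Perm ℕ}
    (hf : ComputableInDeg d f) : f ∈ computablePerm d :=
  ⟨f, hf, fun _ => rfl⟩

theorem computableInDeg_of_mem_computablePerm {d : SetDegree} {f : Equiv.Perm ℕ}
    (hf : f ∈ computablePerm d) : ComputableInDeg d f := by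
  obtain ⟨g, hg, h⟩ := hf
  exact hg.of_eq h

section PermHom

variable {F : Type*} [Field F]

theorem map_domLCongr_mem (ν : ComputableField F) {d : SetDegree} {f : Equiv.Perm ℕ}
    (hf : f ∈ computablePerm d) {W : Submodule F (VInf F)} (hW : W ∈ LatticeOfCESubspaces ν d) :
    W.map (Finsupp.domLCongr f : VInf F ≃ₗ[F] VInf F).toLinearMap ∈ LatticeOfCESubspaces ν d := by
  obtain ⟨v, hv, hr⟩ := mem_latticeOfCESubspaces_iff.1 hW
  refine mem_latticeOfCESubspaces_iff.2 ⟨_, hv.map (T := (Finsupp.domLCongr f :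
    VInf F ≃ₗ[F] VInf F).toLinearMap) (.of_basis ?_), ?_⟩
  · simpa [Finsupp.domLCongr_single] using
      VecSeqComputable.single_one.comp (computableInDeg_of_mem_computablePerm hf)
  · rw [Submodule.map_coe, ← hr, ← Set.range_comp]
    rfl

theorem map_domLCongr_mul (f g : Equiv.Perm ℕ) (W : Submodule F (VInf F)) :
    W.map (Finsupp.domLCongr (f * g) : VInf F ≃ₗ[F] VInf F).toLinearMap =
      (W.map (Finsupp.domLCongr g : VInf F ≃ₗ[F] VInf F).toLinearMap).map
        (Finsupp.domLCongr f : VInf F ≃ₗ[F] VInf F).toLinearMap := by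
  rw [← Submodule.map_comp]
  congr 1
  exact Finsupp.lhom_ext' fun i => LinearMap.ext_ring (by simp)

theorem map_domLCongr_one (W : Submodule F (VInf F)) :
    W.map (Finsupp.domLCongr 1 : VInf F ≃ₗ[F] VInf F).toLinearMap = W := by
  have : (Finsupp.domLCongr 1 : VInf F ≃ₗ[F] VInf F).toLinearMap = LinearMap.id :=
    Finsupp.lhom_ext' fun i => LinearMap.ext_ring (by simp)
  rw [this, Submodule.map_id]

/-- A permutation of the basis acts on the computably enumerable subspaces. -/
noncomputable def permLatticeAut (ν : ComputableField F) (d : SetDegree) :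
    computablePerm d →* (LatticeOfCESubspaces ν d ≃o LatticeOfCESubspaces ν d) where
  toFun f :=
    { toFun := fun W => ⟨_, map_domLCongr_mem ν f.2 W.2⟩
      invFun := fun W => ⟨_, map_domLCongr_mem ν f⁻¹.2 W.2⟩
      left_inv := fun W => Subtype.ext <| by
        change ((W.1.map _).map _) = W.1
        rw [← map_domLCongr_mul, ← Subgroup.coe_mul, inv_mul_cancel]
        exact map_domLCongr_one _
      right_inv := fun W => Subtype.ext <| by
        change ((W.1.map _).map _) = W.1
        rw [← map_domLCongr_mul, ← Subgroup.coe_mul, mul_inv_cancel]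
        exact map_domLCongr_one _
      map_rel_iff' := fun {W W'} =>
        Submodule.map_le_map_iff_of_injective (LinearEquiv.injective _) W.1 W'.1 }
  map_one' := RelIso.ext fun W => Subtype.ext (map_domLCongr_one _)
  map_mul' f g := RelIso.ext fun W => Subtype.ext (map_domLCongr_mul _ _ _)

/-- If the line of each basis vector is fixed, then each permuted basis vector is a multiple of the
original one, which forces equal indices. -/
theorem permLatticeAut_injective (ν : ComputableField F) (d : SetDegree) :
    Function.Injective (permLatticeAut ν d) := by
  refine (injective_iff_map_eq_one _).2 fun f hf => Subtype.ext (Equiv.ext fun i => ?_)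
  have h : (Submodule.span F {(Finsupp.single i 1 : VInf F)}).map
      (Finsupp.domLCongr f.1 : VInf F ≃ₗ[F] VInf F).toLinearMap =
      Submodule.span F {(Finsupp.single i 1 : VInf F)} :=
    congrArg Subtype.val (DFunLike.congr_fun hf (ceLine ν d (Finsupp.single i 1)))
  have hmem : (Finsupp.single (f.1 i) 1 : VInf F) ∈
      Submodule.span F {(Finsupp.single i 1 : VInf F)} := by
    rw [← h, Submodule.map_span]
    refine Submodule.subset_span ⟨_, rfl, ?_⟩
    simp
  obtain ⟨c, hc⟩ := Submodule.mem_span_singleton.1 hmem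
  by_contra hne
  have hne' : i ≠ f.1 i := fun h => hne h.symm
  simpa [hne'] using DFunLike.congr_fun hc (f.1 i)

end PermHom

/-- The translation by `3` of the integers, transported to the natural numbers by coding the
integers `0, -1, 1, -2, 2, …` as `0, 1, 2, 3, 4, …`. -/
def intTranslation : Equiv.Perm ℕ where
  -- The code `2 * k` stands for `k` and `2 * k + 1` for `-k - 1`. The value `5 - n` handles the
  -- codes `1`, `3`, `5` of `-1`, `-2`, `-3`, which cross to `2`, `1`, `0`.
  toFun n := if n % 2 = 0 then n + 6 else if n < 6 then 5 - n else n - 6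
  invFun n := if n % 2 = 1 then n + 6 else if n < 6 then 5 - n else n - 6
  left_inv n := by grind
  right_inv n := by grind

theorem intTranslation_pow (n k : ℕ) : (intTranslation ^ n) (2 * k) = 2 * k + 6 * n := by
  induction n with
  | zero => rfl
  | succ n ih =>
    rw [pow_succ', Equiv.Perm.mul_apply, ih]
    simp only [intTranslation, Equiv.coe_fn_mk]
    rw [if_pos (by omega)]
    ring

theorem intTranslation_mem (d : SetDegree) : intTranslation ∈ computablePerm d := by
  refine ComputableInDeg.mem_computablePerm (.of_computable (Primrec.to_comp ?_))
  exact Primrec.ite (Primrec.eq.comp (Primrec.nat_mod.comp .id (.const 2)) (.const 0))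
    (Primrec.nat_add.comp .id (.const 6))
    (Primrec.ite (Primrec.nat_lt.comp .id (.const 6)) (Primrec.nat_sub.comp (.const 5) .id)
      (Primrec.nat_sub.comp .id (.const 6)))

open Classical in
/-- The involution exchanging `6 * n` with `6 * n + 2` for all `n ∉ B`. -/
noncomputable def swapOutside (B : Set ℕ) : Equiv.Perm ℕ :=
  Function.Involutive.toPerm
    (fun n => if n / 6 ∈ B then n else if n % 6 = 0 then n + 2 else if n % 6 = 2 then n - 2 else n)
    fun n => by
      by_cases hB : n / 6 ∈ B
      · simp [hB]
      · have h2 : (n + 2) / 6 = n / 6 ∨ n % 6 ≠ 0 := by omega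
        have h3 : (n - 2) / 6 = n / 6 ∨ n % 6 ≠ 2 := by omega
        grind

open Classical in
theorem swapOutside_apply (B : Set ℕ) (n : ℕ) : swapOutside B n =
    if n / 6 ∈ B then n else if n % 6 = 0 then n + 2 else if n % 6 = 2 then n - 2 else n := rfl

theorem decidableInDeg_mem {d : SetDegree} {B : Set ℕ} (hB : ComputableInDeg d (charFun B)) :
    DecidableInDeg d fun n => n ∈ B :=
  (DecidableInDeg.eq hB (.const 1)).congr fun n => by simp [charFun]

theorem swapOutside_mem {d : SetDegree} {B : Set ℕ} (hB : ComputableInDeg d (charFun B)) :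
    swapOutside B ∈ computablePerm d := by
  classical
  refine ComputableInDeg.mem_computablePerm (.of_eq ?_ fun n => (swapOutside_apply B n).symm)
  exact .ite ((decidableInDeg_mem hB).comp
      (.of_computable (Primrec.nat_div.comp .id (.const 6)).to_comp)) .id
    (.ite (decidableInDeg_mod 6 0) (.of_computable (Primrec.nat_add.comp .id (.const 2)).to_comp)
      (.ite (decidableInDeg_mod 6 2) (.of_computable (Primrec.nat_sub.comp .id (.const 2)).to_comp)
        .id))

/-- Conjugation brings block `n` to the codes `0`, `2`, `4`. There the conjugate exchanges `0` and
`2` if `n ∉ B` and fixes all three otherwise; the transposition of `2` and `4` commutes with it only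
in the second case. -/
theorem codesSets_computablePerm (d : SetDegree) : CodesSets d (computablePerm d) := by
  classical
  intro B hB
  have hswap : Equiv.swap 2 4 ∈ computablePerm d := by
    refine ComputableInDeg.mem_computablePerm (.of_eq ?_ fun n => (Equiv.swap_apply_def 2 4 n).symm)
    exact .ite (.eq .id (.const 2)) (.const 4) (.ite (.eq .id (.const 4)) (.const 2) .id)
  refine ⟨⟨_, intTranslation_mem d⟩, ⟨_, swapOutside_mem hB⟩, ⟨_, hswap⟩, fun n => ?_⟩
  obtain ⟨c, hc'⟩ : ∃ c, c = (intTranslation ^ n)⁻¹ * swapOutside B * intTranslation ^ n := ⟨_, rfl⟩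
  have hc : ∀ i j, swapOutside B (2 * i + 6 * n) = 2 * j + 6 * n → c (2 * i) = 2 * j := by
    intro i j h
    rw [hc', Equiv.Perm.mul_apply, Equiv.Perm.mul_apply, intTranslation_pow, h,
      ← intTranslation_pow]
    exact (intTranslation ^ n).symm_apply_apply _
  have hcomm : Commute c (Equiv.swap 2 4) ↔ n ∈ B := by
    constructor
    · intro h
      by_contra hn
      have h0 : c 0 = 2 := hc 0 1 (by
        rw [swapOutside_apply, if_neg (by rwa [show (2 * 0 + 6 * n) / 6 = n by omega]),
          if_pos (by omega)]
        ring)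
      -- At `0` the two products give `2` and `4`.
      have := Equiv.congr_fun h.eq 0
      rw [Equiv.Perm.mul_apply, Equiv.Perm.mul_apply, h0, Equiv.swap_apply_left,
        Equiv.swap_apply_of_ne_of_ne (by omega) (by omega), h0] at this
      omega
    · intro hn
      have hfix : ∀ i < 3, c (2 * i) = 2 * i := fun i hi => hc i i (by
        rw [swapOutside_apply, if_pos (by rwa [show (2 * i + 6 * n) / 6 = n by omega])])
      have h := Equiv.mul_swap_eq_swap_mul c 2 4
      rwa [hfix 1 (by omega), hfix 2 (by omega)] at h
  rw [← hcomm, hc']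
  exact Subtype.ext_iff

/-! ### Coding by order automorphisms of the rationals -/

theorem exists_eq_ratNum :
    ∃ e : ℕ → ℕ → Bool, Computable₂ e ∧ ∀ m n, e m n = true ↔ ratNum m = ratNum n := by
  classical
  have h : Primrec fun p : ℕ × ℕ => decide (rayLe (p.1 + 1) (p.2 + 1) ∧
      rayLe (p.2 + 1) (p.1 + 1)) := by
    have h1 := Primrec.succ.comp (Primrec.fst (α := ℕ) (β := ℕ))
    have h2 := Primrec.succ.comp (Primrec.snd (α := ℕ) (β := ℕ))
    exact PrimrecPred.decide ((rayLe_primrec.comp h1 h2).and (rayLe_primrec.comp h2 h1))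
  refine ⟨fun m n => decide (rayLe (m + 1) (n + 1) ∧ rayLe (n + 1) (m + 1)), h.to_comp,
    fun m n => ?_⟩
  rw [decide_eq_true_iff, rayLe_succ, rayLe_succ, le_antisymm_iff]

/-- The group of `d`-computable order automorphisms of the rationals. -/
def computableRatAut (d : SetDegree) : Subgroup (ℚ ≃o ℚ) where
  carrier := {f | MapComputableIn ratNum d f}
  mul_mem' hf hg := MapComputableIn.comp (ν := ratNum) hf hg
  one_mem' := MapComputableIn.id ratNum d
  inv_mem' {f} hf := by
    obtain ⟨e, he, heq⟩ := exists_eq_ratNum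
    exact MapComputableIn.symm ratNum_surjective he heq f.toEquiv hf

/-- An order automorphism moves a ray by moving its endpoint and commutes with symmetric
differences, so it acts on codes entry by entry. Code `0`, the whole line, stays; the shift by one
matches `rayNum`. -/
theorem image_raySum {f : ℚ ≃o ℚ} {g : ℕ → ℕ} (h : ∀ n, ratNum (g n) = f (ratNum n))
    (l : List ℕ) : raySum (l.map fun k => if k = 0 then 0 else g (k - 1) + 1) = f '' raySum l := by
  have hray : ∀ k, rayNum (if k = 0 then 0 else g (k - 1) + 1) = f '' rayNum k := fun k => by
    cases k with
    | zero => simp [rayNum, Set.image_univ, f.surjective.range_eq]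
    | succ k => simp [rayNum, h, OrderIso.image_Ici]
  induction l with
  | nil => simp [raySum]
  | cons k l ih =>
    simp only [raySum, List.map_cons, List.foldr_cons] at ih ⊢
    rw [ih, hray, Set.image_symmDiff f.injective]

theorem image_mem_BEta (f : ℚ ≃o ℚ) {S : Set ℚ} (hS : S ∈ BEta) : f '' S ∈ BEta := by
  obtain ⟨n, hn⟩ := bEtaNum_surjective ⟨S, hS⟩
  have hn' : raySum (Denumerable.ofNat (List ℕ) n) = S := congrArg Subtype.val hn
  choose g hg using fun n => ratNum_surjective (f (ratNum n))
  rw [← hn', ← image_raySum hg]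
  exact raySum_mem _

/-- An order automorphism of the rationals acts on the interval algebra. -/
def ratAutBEta : (ℚ ≃o ℚ) →* (BEta ≃o BEta) where
  toFun f :=
    { toFun := fun S => ⟨f '' S, image_mem_BEta f S.2⟩
      invFun := fun S => ⟨f.symm '' S, image_mem_BEta f.symm S.2⟩
      left_inv := fun _ => Subtype.ext (f.toEquiv.symm_image_image _)
      right_inv := fun _ => Subtype.ext (f.toEquiv.image_symm_image _)
      map_rel_iff' := fun {_ _} => Set.image_subset_image_iff f.injective }
  map_one' := RelIso.ext fun _ => Subtype.ext (Set.image_id _)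
  map_mul' f g := RelIso.ext fun _ => Subtype.ext (Set.image_comp f g _)

theorem ratAutBEta_injective : Function.Injective ratAutBEta := by
  refine (injective_iff_map_eq_one _).2 fun f hf => RelIso.ext fun q => ?_
  have hq : Set.Ici q ∈ BEta := by
    obtain ⟨n, rfl⟩ := ratNum_surjective q
    exact rayNum_mem (n + 1)
  have h : f '' Set.Ici q = Set.Ici q := congrArg Subtype.val (DFunLike.congr_fun hf (⟨Set.Ici q, hq⟩ : BEta))
  rw [OrderIso.image_Ici] at h
  exact Set.Ici_injective h

theorem ratAutBEta_mem {d : SetDegree} {f : ℚ ≃o ℚ} (hf : f ∈ computableRatAut d) :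
    ratAutBEta f ∈ AutBEta d := by
  obtain ⟨g, hg, h⟩ := hf
  have hstep : ComputableInDeg d fun p =>
      if p.unpair.2 = 0 then 0 else g (p.unpair.2 - 1) + 1 :=
    .ite (.eq .right (.const 0)) (.const 0) (ComputableInDeg.succ.comp (hg.comp
      ((ComputableInDeg.of_computable (Primrec.nat_sub.comp .id (.const 1)).to_comp).comp .right)))
  refine ⟨_, hstep.listMap.comp (ComputableInDeg.const 0 |>.pair .id), fun n => Subtype.ext ?_⟩
  simp only [bEtaNum, Nat.unpair_pair, Denumerable.ofNat_encode]
  exact image_raySum h _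

/-- The restriction of `ratAutBEta` to the computable automorphisms. -/
def computableRatAutBEta (d : SetDegree) : computableRatAut d →* AutBEta d :=
  (ratAutBEta.comp (computableRatAut d).subtype).codRestrict (AutBEta d) fun f =>
    ratAutBEta_mem f.2

theorem computableRatAutBEta_injective (d : SetDegree) :
    Function.Injective (computableRatAutBEta d) := fun _ _ h =>
  Subtype.ext (ratAutBEta_injective (congrArg Subtype.val h))

/-! ### Translations and piecewise linear bumps of the rationals -/

theorem ratNum_mk (i j k : ℕ) :
    ratNum (Nat.pair (Nat.pair i j) k) = ((i : ℚ) - j) / (k + 1) := by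
  simp [ratNum]

/-- The translation of the rationals by `1`. -/
def ratTranslation : ℚ ≃o ℚ := OrderIso.addRight 1

theorem ratTranslation_apply (x : ℚ) : ratTranslation x = x + 1 := rfl

theorem ratTranslation_inv_apply (x : ℚ) : ratTranslation⁻¹ x = x - 1 :=
  (sub_eq_add_neg x 1).symm

theorem ratTranslation_pow_apply (n : ℕ) (x : ℚ) : (ratTranslation ^ n) x = x + n := by
  induction n with
  | zero => simp
  | succ n ih =>
    rw [pow_succ', RelIso.mul_apply, ih, ratTranslation_apply]
    push_cast
    ring

theorem ratTranslation_pow_inv_apply (n : ℕ) (x : ℚ) :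
    (ratTranslation ^ n)⁻¹ x = x - n := by
  refine (ratTranslation ^ n).injective ?_
  rw [ratTranslation_pow_apply n (x - n), sub_add_cancel]
  exact (ratTranslation ^ n).apply_symm_apply x

theorem ratTranslation_mem (d : SetDegree) : ratTranslation ∈ computableRatAut d := by
  have h : Primrec fun n : ℕ => Nat.pair (Nat.pair (n.unpair.1.unpair.1 + (n.unpair.2 + 1))
      n.unpair.1.unpair.2) n.unpair.2 := by
    have hl := Primrec.fst.comp Primrec.unpair
    have hr := Primrec.snd.comp Primrec.unpair
    exact Primrec₂.natPair.comp (Primrec₂.natPair.comp (Primrec.nat_add.comp (hl.comp hl)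
      (Primrec.succ.comp hr)) (hr.comp hl)) hr
  refine ⟨_, .of_computable h.to_comp, fun n => ?_⟩
  rw [ratNum_mk, ratNum, ratTranslation_apply]
  have : (n.unpair.2 : ℚ) + 1 ≠ 0 := by positivity
  field_simp
  push_cast
  ring

/-- The piecewise linear bump supported on `(4 * n, 4 * n + 3)`. -/
def bump (n x : ℚ) : ℚ := max x (min (2 * x - 4 * n) ((x + 4 * n + 3) / 2))

/-- The inverse of the bump. -/
def bumpInv (n x : ℚ) : ℚ := min x (max ((x + 4 * n) / 2) (2 * x - 4 * n - 3))

theorem bumpInv_bump (n x : ℚ) : bumpInv n (bump n x) = x := by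
  simp only [bump, bumpInv]
  grind

theorem bump_bumpInv (n x : ℚ) : bump n (bumpInv n x) = x := by
  simp only [bump, bumpInv]
  grind

theorem bump_mono (n : ℚ) : Monotone (bump n) := fun x y h => by
  simp only [bump]
  gcongr

theorem bump_eq_self {n x : ℚ} (h : x ≤ 4 * n ∨ 4 * n + 3 ≤ x) : bump n x = x := by
  simp only [bump]
  grind

open Classical in
/-- The map acting as a bump on the block `[4 * n, 4 * n + 4)` for all `n ∈ B`. -/
noncomputable def blockBump (B : Set ℕ) (x : ℚ) : ℚ :=
  if ∃ n ∈ B, ⌊x / 4⌋ = (n : ℤ) then bump ⌊x / 4⌋ x else x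

theorem floor_div_four_eq {x : ℚ} {n : ℤ} : ⌊x / 4⌋ = n ↔ 4 * n ≤ x ∧ x < 4 * n + 4 := by
  rw [Int.floor_eq_iff, le_div_iff₀ (by norm_num), div_lt_iff₀ (by norm_num)]
  constructor <;> rintro ⟨h1, h2⟩ <;> constructor <;> linarith

theorem floor_bump {x : ℚ} : ⌊bump ⌊x / 4⌋ x / 4⌋ = ⌊x / 4⌋ := by
  obtain ⟨h1, h2⟩ := floor_div_four_eq.1 (rfl : ⌊x / 4⌋ = ⌊x / 4⌋)
  rw [floor_div_four_eq]
  simp only [bump]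
  grind

theorem floor_bumpInv {x : ℚ} : ⌊bumpInv ⌊x / 4⌋ x / 4⌋ = ⌊x / 4⌋ := by
  obtain ⟨h1, h2⟩ := floor_div_four_eq.1 (rfl : ⌊x / 4⌋ = ⌊x / 4⌋)
  rw [floor_div_four_eq]
  simp only [bumpInv]
  grind

theorem floor_blockBump (B : Set ℕ) (x : ℚ) : ⌊blockBump B x / 4⌋ = ⌊x / 4⌋ := by
  rw [blockBump]
  split_ifs
  exacts [floor_bump, rfl]

/-- Within a block a single monotone map acts; points of different blocks keep their order because
every block is preserved. -/
theorem blockBump_mono (B : Set ℕ) : Monotone (blockBump B) := by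
  intro x y hxy
  rcases (Int.floor_mono (div_le_div_of_nonneg_right hxy (by norm_num : (0 : ℚ) ≤ 4))).eq_or_lt
    with h | h
  · rw [blockBump, blockBump, h]
    split_ifs
    exacts [bump_mono _ hxy, hxy]
  · rw [← floor_blockBump B x, ← floor_blockBump B y] at h
    refine le_of_lt (lt_of_not_ge fun hle => h.not_ge (Int.floor_mono ?_))
    exact div_le_div_of_nonneg_right hle (by norm_num)

open Classical in
/-- The automorphism acting as a bump on the block `[4 * n, 4 * n + 4)` for all `n ∈ B`. -/
noncomputable def blockBumpAut (B : Set ℕ) : ℚ ≃o ℚ :=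
  let e : ℚ ≃ ℚ :=
    { toFun := blockBump B
      invFun := fun x => if ∃ n ∈ B, ⌊x / 4⌋ = (n : ℤ) then bumpInv ⌊x / 4⌋ x else x
      left_inv := fun x => by
        simp only [floor_blockBump]
        by_cases h : ∃ n ∈ B, ⌊x / 4⌋ = (n : ℤ)
        · rw [if_pos h, blockBump, if_pos h, bumpInv_bump]
        · rw [if_neg h, blockBump, if_neg h]
      right_inv := fun x => by
        beta_reduce
        by_cases h : ∃ n ∈ B, ⌊x / 4⌋ = (n : ℤ)
        · rw [if_pos h, blockBump, floor_bumpInv, if_pos h, bump_bumpInv]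
        · rw [if_neg h, blockBump, if_neg h] }
  e.toOrderIso (blockBump_mono B) fun x y h => by
    by_contra hlt
    have := blockBump_mono B (le_of_not_ge hlt)
    have h1 : e (e.symm x) ≤ e (e.symm y) := by simpa using h
    have h2 : e (e.symm y) ≤ e (e.symm x) := this
    exact hlt (e.injective (le_antisymm h1 h2)).le

theorem blockBumpAut_apply (B : Set ℕ) (x : ℚ) : blockBumpAut B x = blockBump B x := rfl

theorem blockBump_of_mem {B : Set ℕ} {n : ℕ} (hn : n ∈ B) {x : ℚ} (h1 : 4 * n ≤ x)
    (h2 : x < 4 * n + 4) : blockBump B x = bump n x := by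
  have h : ⌊x / 4⌋ = (n : ℤ) := floor_div_four_eq.2 ⟨by exact_mod_cast h1, by exact_mod_cast h2⟩
  rw [blockBump, if_pos ⟨n, hn, h⟩, h]
  simp

/-- The window starts at `4 * n - 1` because the preceding bump ends there: bumps have length three
in blocks of length four. This gap makes room for the test element in the coding. -/
theorem blockBump_of_notMem {B : Set ℕ} {n : ℕ} (hn : n ∉ B) {x : ℚ} (h1 : 4 * n - 1 ≤ x)
    (h2 : x < 4 * n + 4) : blockBump B x = x := by
  rw [blockBump]
  split_ifs with h
  · refine bump_eq_self (Or.inr ?_)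
    obtain ⟨m, hm, h⟩ := h
    have h' := floor_div_four_eq.1 h
    rw [h]
    push_cast at h' ⊢
    have hmn : m ≠ n := fun he => hn (he ▸ hm)
    rcases lt_or_gt_of_ne hmn with hlt | hlt
    · have : (m : ℚ) + 1 ≤ n := by exact_mod_cast hlt
      linarith
    · have : (n : ℚ) + 1 ≤ m := by exact_mod_cast hlt
      linarith [h'.1]
  · rfl

theorem blockBumpAut_mem {d : SetDegree} {B : Set ℕ} (hB : ComputableInDeg d (charFun B)) :
    blockBumpAut B ∈ computableRatAut d := by
  classical
  -- For a nonnegative rational, `N` is the numerator over `k + 1`, `r` the index of its block, and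
  -- `s` the numerator of the left end of that block. Negative rationals lie in no block of `B` and
  -- are fixed.
  let N : ℕ → ℕ := fun n => n.unpair.1.unpair.1 - n.unpair.1.unpair.2
  let k : ℕ → ℕ := fun n => n.unpair.2
  let r : ℕ → ℕ := fun n => N n / (4 * (k n + 1))
  let s : ℕ → ℕ := fun n => 4 * r n * (k n + 1)
  have hi := (Primrec.fst.comp Primrec.unpair).comp (Primrec.fst.comp Primrec.unpair)
  have hj := (Primrec.snd.comp Primrec.unpair).comp (Primrec.fst.comp Primrec.unpair)
  have hN : Primrec N := Primrec.nat_sub.comp hi hj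
  have hk : Primrec k := Primrec.snd.comp Primrec.unpair
  have hr : Primrec r := Primrec.nat_div.comp hN
    (Primrec.nat_mul.comp (.const 4) (Primrec.succ.comp hk))
  have hs : Primrec s := Primrec.nat_mul.comp (Primrec.nat_mul.comp (.const 4) hr)
    (Primrec.succ.comp hk)
  have h3 := Primrec.nat_mul.comp (.const 3) (Primrec.succ.comp hk)
  have hc : ComputableInDeg d fun n => if n.unpair.1.unpair.2 ≤ n.unpair.1.unpair.1 ∧ r n ∈ B then
      if N n ≤ s n + (k n + 1) then Nat.pair (Nat.pair (2 * N n) (s n)) (k n) else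
        if N n ≤ s n + 3 * (k n + 1) then
          -- The doubled denominator `2 * (k + 1)` is coded by `2 * k + 1`, one less than its value.
          Nat.pair (Nat.pair (N n + s n + 3 * (k n + 1)) 0) (2 * k n + 1) else n else n := by
    refine .ite ((DecidableInDeg.of_primrecPred (Primrec.nat_le.comp hj hi)).and
      ((decidableInDeg_mem hB).comp (.of_computable hr.to_comp))) (.ite (.of_primrecPred
        (Primrec.nat_le.comp hN (Primrec.nat_add.comp hs (Primrec.succ.comp hk))))
          (.of_computable (Primrec.to_comp ?_)) (.ite (.of_primrecPred (Primrec.nat_le.comp hN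
            (Primrec.nat_add.comp hs h3))) (.of_computable (Primrec.to_comp ?_)) .id)) .id
    · exact Primrec₂.natPair.comp (Primrec₂.natPair.comp (Primrec.nat_mul.comp (.const 2) hN) hs) hk
    · exact Primrec₂.natPair.comp (Primrec₂.natPair.comp (Primrec.nat_add.comp
        (Primrec.nat_add.comp hN hs) h3) (.const 0))
          (Primrec.succ.comp (Primrec.nat_mul.comp (.const 2) hk))
  refine ⟨_, hc, fun n => ?_⟩
  rw [blockBumpAut_apply]
  have hK : (0 : ℚ) < (k n : ℚ) + 1 := by positivity
  by_cases hle : n.unpair.1.unpair.2 ≤ n.unpair.1.unpair.1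
  · have hx : ratNum n = N n / (k n + 1) := by
      simp only [ratNum, N, k]
      rw [Nat.cast_sub hle]
    have hb1 : 4 * (r n : ℚ) ≤ ratNum n := by
      rw [hx, le_div_iff₀ hK]
      have := Nat.div_mul_le_self (N n) (4 * (k n + 1))
      have h' : 4 * r n * (k n + 1) ≤ N n := by calc
        4 * r n * (k n + 1) = r n * (4 * (k n + 1)) := by ring
        _ ≤ N n := this
      exact_mod_cast h'
    have hb2 : ratNum n < 4 * (r n : ℚ) + 4 := by
      rw [hx, div_lt_iff₀ hK]
      have := Nat.lt_div_mul_add (a := N n) (b := 4 * (k n + 1)) (by omega)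
      have h' : N n < (4 * r n + 4) * (k n + 1) := by calc
        N n < r n * (4 * (k n + 1)) + 4 * (k n + 1) := this
        _ = (4 * r n + 4) * (k n + 1) := by ring
      exact_mod_cast h'
    by_cases hB' : r n ∈ B
    · rw [if_pos ⟨hle, hB'⟩, blockBump_of_mem hB' hb1 hb2]
      have hN1 : N n ≤ s n + (k n + 1) ↔ ratNum n ≤ 4 * r n + 1 := by
        rw [hx, div_le_iff₀ hK, ← Nat.cast_le (α := ℚ)]
        simp only [s]
        push_cast
        rw [add_mul, one_mul]
      have hN3 : N n ≤ s n + 3 * (k n + 1) ↔ ratNum n ≤ 4 * r n + 3 := by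
        rw [hx, div_le_iff₀ hK, ← Nat.cast_le (α := ℚ)]
        simp only [s]
        push_cast
        rw [add_mul]
      simp only [hN1, hN3]
      split_ifs with h1 h2
      · have : bump (r n) (ratNum n) = 2 * ratNum n - 4 * r n := by
          simp only [bump]; grind
        rw [this, ratNum_mk, hx]
        simp only [s]
        push_cast
        field_simp
      · have : bump (r n) (ratNum n) = (ratNum n + 4 * r n + 3) / 2 := by
          simp only [bump]; grind
        rw [this, ratNum_mk, hx]
        simp only [s]
        push_cast
        field_simp
        ring
      · exact (bump_eq_self (Or.inr (le_of_not_ge h2))).symm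
    · rw [if_neg fun h => hB' h.2, blockBump_of_notMem hB' (by linarith) hb2]
  · rw [if_neg fun h => hle h.1, blockBump, if_neg]
    rintro ⟨m, -, hm⟩
    have h0 := (floor_div_four_eq.1 hm).1
    have hneg : ratNum n < 0 := by
      have : (n.unpair.1.unpair.1 : ℚ) < n.unpair.1.unpair.2 := by exact_mod_cast not_le.1 hle
      exact div_neg_of_neg_of_pos (by linarith) hK
    push_cast at h0
    have : (0 : ℚ) ≤ m := by positivity
    linarith

/-- The bumps are placed on the blocks outside `B`, and `u` is the bump of block `0` moved left by
one, with support in `(-1, 2)`. If `n ∈ B`, the conjugate is the identity on `[-1, 4)`, so the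
supports are disjoint. Otherwise it has a bump on `(0, 3)`, which overlaps that of `u` without
commuting with it. -/
theorem codesSets_computableRatAut (d : SetDegree) : CodesSets d (computableRatAut d) := by
  classical
  intro B hB
  have hS : blockBumpAut Bᶜ ∈ computableRatAut d := blockBumpAut_mem <|
    (ComputableInDeg.comp₂ Primrec.nat_sub.to_comp (.const 1) hB).of_eq
      fun n => (charFun_compl B n).symm
  have h0 : blockBumpAut {0} ∈ computableRatAut d := blockBumpAut_mem <| by
    refine (ComputableInDeg.ite (.eq .id (.const 0)) (.const 1) (.const 0)).of_eq fun n => ?_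
    simp [charFun]
  have ht := ratTranslation_mem d
  refine ⟨⟨_, pow_mem ht 4⟩, ⟨_, hS⟩, ⟨_, mul_mem (mul_mem (inv_mem ht) h0) ht⟩, fun n => ?_⟩
  obtain ⟨c, hc⟩ : ∃ c, c = ((ratTranslation ^ 4) ^ n)⁻¹ * blockBumpAut Bᶜ *
    (ratTranslation ^ 4) ^ n := ⟨_, rfl⟩
  obtain ⟨u, hu⟩ : ∃ u, u = ratTranslation⁻¹ * blockBumpAut {0} * ratTranslation := ⟨_, rfl⟩
  have hc' : ∀ x, c x = blockBump Bᶜ (x + 4 * n) - 4 * n := fun x => by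
    rw [hc, ← pow_mul, RelIso.mul_apply, RelIso.mul_apply, ratTranslation_pow_apply,
      ratTranslation_pow_inv_apply, blockBumpAut_apply]
    push_cast
    rfl
  have hu' : ∀ x, u x = blockBump {0} (x + 1) - 1 := fun x => by
    rw [hu, RelIso.mul_apply, RelIso.mul_apply, ratTranslation_apply,
      ratTranslation_inv_apply, blockBumpAut_apply]
  have hcomm : Commute c u ↔ n ∈ B := by
    constructor
    · intro h
      by_contra hn
      -- At the point `1` the two products take the values `9 / 4` and `2`.
      have := DFunLike.congr_fun h.eq 1
      rw [RelIso.mul_apply, RelIso.mul_apply] at this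
      have hcx : ∀ x : ℚ, 0 ≤ x → x < 4 → c x = bump n (x + 4 * n) - 4 * n := fun x h1 h2 => by
        rw [hc', blockBump_of_mem (show n ∈ Bᶜ from hn) (by linarith) (by linarith)]
      have hux : ∀ x : ℚ, -1 ≤ x → x < 3 → u x = bump 0 (x + 1) - 1 := fun x h1 h2 => by
        rw [hu', blockBump_of_mem (n := 0) (Set.mem_singleton 0) (by push_cast; linarith) (by push_cast; linarith)]
        simp
      have e1 : c 1 = 2 := by
        rw [hcx 1 (by norm_num) (by norm_num)]; simp only [bump]; grind
      have e2 : u 2 = 2 := by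
        rw [hux 2 (by norm_num) (by norm_num)]; simp only [bump]; norm_num
      have e3 : u 1 = 3 / 2 := by
        rw [hux 1 (by norm_num) (by norm_num)]; simp only [bump]; norm_num
      have e4 : c (3 / 2) = 9 / 4 := by
        rw [hcx _ (by norm_num) (by norm_num)]; simp only [bump]; grind
      rw [e1, e2, e3, e4] at this
      norm_num at this
    · intro hn
      have hdisj : Equiv.Perm.Disjoint c.toEquiv u.toEquiv := fun x => by
        change c x = x ∨ u x = x
        by_cases hx : -1 ≤ x ∧ x < 3
        · left
          rw [hc', blockBump_of_notMem (n := n) (by simpa using hn) (by linarith) (by linarith)]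
          ring
        · right
          rw [hu', blockBump]
          split_ifs with h
          · obtain ⟨m, rfl, h⟩ := h
            have := floor_div_four_eq.1 h
            rw [h, bump_eq_self, add_sub_cancel_right]
            push_cast at this ⊢
            grind
          · ring
      have := hdisj.commute.eq
      exact RelIso.ext fun x => Equiv.congr_fun this x
  rw [← hcomm, hc, hu]
  exact Subtype.ext_iff

/-! ### The two equivalences -/

theorem mainTheorem5 {F : Type*} [Field F] (ν : ComputableField F) (a b : SetDegree) :
    (GroupEmbeds (LatticeOfCESubspaces ν a ≃o LatticeOfCESubspaces ν a)
        (LatticeOfCESubspaces ν b ≃o LatticeOfCESubspaces ν b) ↔ a ≤ b) ∧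
      (GroupEmbeds (AutBEta a) (AutBEta b) ↔ a ≤ b) := by
  refine ⟨⟨le_of_groupEmbeds ?_ (isEffectiveAction_latticeAut ν b),
    fun h => ⟨latticeAutHom ν h, latticeAutHom_injective ν h⟩⟩,
    ⟨le_of_groupEmbeds ?_ (isEffectiveAction_autBEta b),
    fun h => ⟨Subgroup.inclusion (AutBEta_mono h), Subgroup.inclusion_injective _⟩⟩⟩
  · exact (codesSets_computablePerm a).map _ (permLatticeAut_injective ν a)
  · exact (codesSets_computableRatAut a).map _ (computableRatAutBEta_injective a)
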